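/- Let $G$ be a connected undirected graph with nonnegative edge weights (positive on edges) on $N\ge 2$ vertices, with combinatorial Laplacian $L=U\Lambda U^{T}$, where $U$ is orthogonal with columns $u_1,\dots,u_N$ and $\Lambda=\mathrm{diag}(\lambda_1,\dots,\lambda_N)$, $0=\lambda_1<\lambda_2\le\dots\le\lambda_N$. Put $\omega(x)=\frac14\left(\sqrt x+\frac1{\sqrt x}\right)^2$, $r=\omega(\lambda_N/\lambda_2)$ and, for $1\le m\le N$, $$B(m)=r\,\frac Nm+\sum_{i=2}^{m}\omega\!\left(\max\left[1,\frac{\lambda_{N+2-i}}{\lambda_i}\right]\right),$$ and let $m_{opt}\in\{1,\dots,N\}$ be a minimiser of $B$. Let $1\le k\le N$. Consider a random signal $x\in\mathrm{span}(u_1,\dots,u_k)$ with $\mathbb E[x]=0$ and $\mathrm{Cov}(x)=\sum_{i\le k}u_iu_i^{T}$, and full-band noise $n=\sigma\varepsilon$, where $\sigma>0$, $\varepsilon$ is independent of $x$, $\mathbb E[\varepsilon]=0$ and $\mathrm{Cov}(\varepsilon)=I_N$; put $y=x+n$ and $\mathrm{SNR}=\mathbb E\|x\|^2/\mathbb E\|n\|^2$.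 For a nonempty set $S$ of vertices and $\mu>0$, let $\hat x_S$ be the graph-Laplacian regularised (GLR) reconstruction, i.e. the minimiser over $z\in\mathbb R^N$ of $\|z_S-y_S\|^2+\mu z^{T}Lz$, where $v_S$ is the restriction of $v$ to $S$, and let $\mathrm{MSE}_S=\mathbb E\|\hat x_S-x\|^2$. If $B(m_{opt})<N$, then $m_{opt}\le\lceil\frac{N+1}{2}\rceil$, with strict inequality when $N$ is even. Moreover there exist $\mu_{ub}>0$ and a function $\mu\mapsto\tau_{GLR}(\mu)$, positive on $(0,\mu_{ub})$, both depending only on the graph, its eigenbasis $U$, $k$ and $m_{opt}$, such that for every $\mu\in(0,\mu_{ub})$ and every such signal and noise model with $\mathrm{SNR}<\tau_{GLR}(\mu)$, every vertex set $S$ of size $m_{opt}$ satisfies $\mathrm{MSE}_S<\mathrm{MSE}_{\{1,\dots,N\}}$ (full observation). -/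

import Mathlib

open MeasureTheory ProbabilityTheory
open scoped Matrix

universe u

namespace GraphSampling

noncomputable section

/-- The squared Euclidean norm of a real vector. -/
def sqNorm {ι : Type*} [Fintype ι] (v : ι → ℝ) : ℝ := ∑ i, v i ^ 2

/-- An undirected graph on `N` vertices with nonnegative edge weights and no loops; two vertices
are joined by an edge exactly when the weight between them is positive. -/
structure WeightedGraph (N : ℕ) where
  weight : Matrix (Fin N) (Fin N) ℝ
  symm : ∀ i j, weight i j = weight j i
  nonneg : ∀ i j, 0 ≤ weight i j
  loopless : ∀ i, weight i i = 0

namespace WeightedGraph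

variable {N : ℕ} (G : WeightedGraph N)

/-- The underlying simple graph. -/
def toSimpleGraph : SimpleGraph (Fin N) where
  Adj i j := 0 < G.weight i j
  symm := ⟨fun i j h => by rw [G.symm j i]; exact h⟩
  loopless := ⟨fun i h => by rw [G.loopless i] at h; exact lt_irrefl _ h⟩

/-- The combinatorial Laplacian: diagonal matrix of weighted degrees minus weight matrix. -/
def laplacian : Matrix (Fin N) (Fin N) ℝ :=
  Matrix.diagonal (fun i => ∑ j, G.weight i j) - G.weight

end WeightedGraph

/-- `L = U Λ Uᵀ` with `U` orthogonal and `Λ = diag(lam)`, the eigenvalues being listed in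
nondecreasing order. The columns of `U` are an orthonormal eigenbasis. -/
structure IsEigendecomposition {N : ℕ} (L U : Matrix (Fin N) (Fin N) ℝ) (lam : Fin N → ℝ) :
    Prop where
  orthogonal : U ∈ Matrix.orthogonalGroup (Fin N) ℝ
  monotone : Monotone lam
  decomp : L = U * Matrix.diagonal lam * Uᵀ

/-- The eigenvalue `λ_i` in one-based numbering, `1 ≤ i ≤ N` (only such `i` are ever used). -/
def eigenvalueAt {N : ℕ} (lam : Fin N → ℝ) (i : ℕ) : ℝ :=
  if h : i - 1 < N then lam ⟨i - 1, h⟩ else 0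

/-- `ω(x) = (1/4) (√x + 1/√x)²`. -/
def omegaK (x : ℝ) : ℝ := 1 / 4 * (Real.sqrt x + 1 / Real.sqrt x) ^ 2

/-- `r = ω(λ_N / λ_2)`. -/
def spreadR {N : ℕ} (lam : Fin N → ℝ) : ℝ :=
  omegaK (eigenvalueAt lam N / eigenvalueAt lam 2)

/-- `B(m) = r N / m + ∑_{i=2}^m ω(max(1, λ_{N+2-i} / λ_i))`, for `1 ≤ m ≤ N`. -/
def boundB {N : ℕ} (lam : Fin N → ℝ) (m : ℕ) : ℝ :=
  spreadR lam * ((N : ℝ) / (m : ℝ)) +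
    ∑ i ∈ Finset.Icc 2 m,
      omegaK (max 1 (eigenvalueAt lam (N + 2 - i) / eigenvalueAt lam i))

/-- `m` is a sample size in `{1, …, N}` at which `B` is minimal. -/
def IsOptimalSampleSize {N : ℕ} (lam : Fin N → ℝ) (m : ℕ) : Prop :=
  m ∈ Set.Icc 1 N ∧ IsMinOn (boundB lam) (Set.Icc 1 N) m

/-- The projection `∑_{i ≤ k} u_i u_iᵀ` onto the span of the first `k` columns of `U`. -/
def bandProjection {N : ℕ} (U : Matrix (Fin N) (Fin N) ℝ) (k : ℕ) :
    Matrix (Fin N) (Fin N) ℝ :=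
  fun a b => ∑ i with i.val < k, U a i * U b i

/-- `v` is a linear combination of the first `k` columns of `U`. -/
def IsBandlimited {N : ℕ} (U : Matrix (Fin N) (Fin N) ℝ) (k : ℕ) (v : Fin N → ℝ) : Prop :=
  ∃ c : Fin N → ℝ, (∀ i, k ≤ i.val → c i = 0) ∧ v = U *ᵥ c

/-- The signal and noise model: `x` is a random `k`-bandlimited signal with mean zero and
covariance the band projection; `ε` is independent of `x`, with mean zero and identity
covariance (full-band noise). -/
structure IsFullBandModel {N : ℕ} (U : Matrix (Fin N) (Fin N) ℝ) (k : ℕ)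
    {Ω : Type u} [MeasurableSpace Ω] (P : Measure Ω) (x ε : Ω → Fin N → ℝ) : Prop where
  signal_memLp : ∀ i, MemLp (fun w => x w i) 2 P
  signal_bandlimited : ∀ᵐ w ∂P, IsBandlimited U k (x w)
  signal_mean : ∀ i, ∫ w, x w i ∂P = 0
  signal_cov : ∀ i j, covariance (fun w => x w i) (fun w => x w j) P = bandProjection U k i j
  noise_memLp : ∀ i, MemLp (fun w => ε w i) 2 P
  noise_mean : ∀ i, ∫ w, ε w i ∂P = 0
  noise_cov : ∀ i j, covariance (fun w => ε w i) (fun w => ε w j) P =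
    (1 : Matrix (Fin N) (Fin N) ℝ) i j
  indep : IndepFun x ε P

/-- Signal-to-noise ratio `E‖x‖² / E‖n‖²`. -/
def snr {N : ℕ} {Ω : Type u} [MeasurableSpace Ω] (P : Measure Ω) (x n : Ω → Fin N → ℝ) : ℝ :=
  (∫ w, sqNorm (x w) ∂P) / (∫ w, sqNorm (n w) ∂P)

/-- The objective of graph-Laplacian regularised reconstruction from observations `y` on `S`:
`z ↦ ‖z_S - y‖² + μ zᵀ L z`. -/
def glrObjective {N : ℕ} (L : Matrix (Fin N) (Fin N) ℝ) (μ : ℝ) (S : Finset (Fin N))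
    (y : S → ℝ) (z : Fin N → ℝ) : ℝ :=
  sqNorm (fun i : S => z i - y i) + μ * (z ⬝ᵥ (L *ᵥ z))

/-- The GLR reconstruction: the minimiser of the GLR objective over all of `ℝ^N`. (The minimiser
exists and is unique for `μ > 0`, `S` nonempty and `L` the Laplacian of a connected graph.) -/
def glrReconstruction {N : ℕ} (L : Matrix (Fin N) (Fin N) ℝ) (μ : ℝ) (S : Finset (Fin N))
    (y : S → ℝ) : Fin N → ℝ :=
  Classical.epsilon fun z => IsMinOn (glrObjective L μ S y) Set.univ z

/-- The mean squared error `E‖x̂ - x‖²` when the signal `x` is reconstructed by GLR from the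
restriction to `S` of the corrupted signal `y`. It is an extended nonnegative real, so that
no integrability convention is involved. -/
def glrMSE {N : ℕ} (L : Matrix (Fin N) (Fin N) ℝ) (μ : ℝ) {Ω : Type u} [MeasurableSpace Ω]
    (P : Measure Ω) (x y : Ω → Fin N → ℝ) (S : Finset (Fin N)) : ENNReal :=
  ∫⁻ w, ENNReal.ofReal
    (sqNorm (glrReconstruction L μ S (fun i : S => y w i) - x w)) ∂P

end

end GraphSampling

open GraphSampling

/-! The GLR reconstruction is linear, `x̂ = R y`, so the error splits into a bias term that does not
involve `σ` and a noise term `σ² ‖R‖²` (Frobenius norm). With all vertices observed, `‖R‖² = ∑ (1 +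
μ λ_i)⁻²`, which tends to `N` as `μ → 0`. For observations on `S`, `‖R‖² ≤ B(|S|)` for every `μ >
0`. Hence `B(m_opt) < N` leaves a gap between the noise terms for small `μ`, and for large `σ`, that
is for small SNR, this gap outweighs every bias.

To bound `‖R‖`, factor `R = H J` on the columns in `S`, with `H` the harmonic extension from `S` and
`J` the `S × S` block of `R`. Since `J` is a symmetric contraction, `‖R‖ ≤ ‖H‖`
(`sum_sq_glrMatrix_le`).

To bound `‖H‖` (`sum_sq_harmonicExtension_le`), split `ℝ^S` into constants, which `H` reproduces,
and zero-sum vectors. In the coordinates `u_2, …, u_N` the extension of a zero-sum `g` is `ι g + T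
g`: `ι` is isometric, `T g` comes from the values off `S` and is orthogonal to the range of `ι`, and
harmonicity makes `T g` orthogonal to every `ι g' + T g'` for the weight `diag(λ_2, …, λ_N)`. The
singular values `s_i` of `T` are then tangents of angles limited by the spectrum, as in the
Kantorovich and Wielandt inequalities. The version needed is a log-majorisation: for each `j`, the
product of the first `j` numbers `(s_i + √(1 + s_i²))²` is at most a product of eigenvalue ratios.
It follows from Cauchy–Binet and Cauchy–Schwarz for `j × j` Gram determinants
(`prod_castLE_mul_prod_sq_le_prod_rev`).

Since `ω(exp t)` is convex in `t`, and `ω` maps `(s + √(1 + s²))²` to `1 + s²`, these product bounds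
become the sum in `B`. The case `j = 1` gives `1 + s_i² ≤ r`; this controls the component of the
extension along `u_1` and produces the term `r N / m`. -/

/-! ### Determinant inequalities for weighted Gram matrices. -/

section Determinants

open Matrix Equiv

/-- A symmetrised form of the Cauchy–Binet formula. -/
theorem factorial_mul_det_transpose_mul {R κ : Type*} [CommRing R] [Fintype κ] {j : ℕ}
    (Y Z : Matrix κ (Fin j) R) :
    (j.factorial : R) * (Yᵀ * Z).det =
      ∑ f : Fin j → κ, (Y.submatrix f id).det * (Z.submatrix f id).det := by
  classical
  have h1 : (Yᵀ * Z).det = ∑ f : Fin j → κ, (∏ i, Y (f i) i) * (Z.submatrix f id).det := by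
    have hrow : (Yᵀ * Z) = fun i => ∑ k, Y k i • Z k := by
      ext i l
      simp [Matrix.mul_apply, Finset.sum_apply]
    have h := (Matrix.detRowAlternating (n := Fin j) (R := R)).toMultilinearMap.map_sum
      (fun i k => Y k i • Z k)
    change (Yᵀ * Z).det = _
    rw [hrow]
    refine h.trans (Finset.sum_congr rfl fun f _ => ?_)
    rw [MultilinearMap.map_smul_univ]
    rfl
  have h2 : ∀ (f : Fin j → κ) (s : Perm (Fin j)),
      ((Perm.sign s : ℤ) : R) * (Z.submatrix f id).det = (Z.submatrix (f ∘ s) id).det := by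
    intro f s
    rw [← Matrix.det_permute]
    rfl
  -- Reindexing the expansion by a permutation does not change it; summing over all permutations
  -- then reassembles `det Y` from its diagonal products.
  have h3 : ∀ s : Perm (Fin j),
      ∑ f : Fin j → κ, (∏ i, Y (f (s i)) i) * (Z.submatrix (f ∘ s) id).det = (Yᵀ * Z).det := by
    intro s
    rw [h1]
    exact Fintype.sum_equiv (Equiv.arrowCongr s.symm (Equiv.refl κ)) _ _ (fun f => by
      simp [Equiv.arrowCongr, Function.comp_def])
  calc (j.factorial : R) * (Yᵀ * Z).det
      = ∑ s : Perm (Fin j), (Yᵀ * Z).det := by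
        simp [Fintype.card_perm]
    _ = ∑ s : Perm (Fin j), ∑ f : Fin j → κ,
          (∏ i, Y (f (s i)) i) * (Z.submatrix (f ∘ s) id).det := by
        simp_rw [h3]
    _ = ∑ f : Fin j → κ, ∑ s : Perm (Fin j),
          (∏ i, Y (f (s i)) i) * (Z.submatrix (f ∘ s) id).det := Finset.sum_comm
    _ = _ := by
        refine Finset.sum_congr rfl fun f _ => ?_
        rw [Matrix.det_apply', Finset.sum_mul]
        refine Finset.sum_congr rfl fun s _ => ?_
        rw [← h2]
        simp only [Matrix.submatrix_apply, id]
        ring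

variable {n j : ℕ}

theorem factorial_mul_det_weighted (w : Fin n → ℝ) (Y Z : Matrix (Fin n) (Fin j) ℝ) :
    (j.factorial : ℝ) * (Yᵀ * diagonal w * Z).det =
      ∑ f : Fin j → Fin n,
        (∏ i, w (f i)) * ((Y.submatrix f id).det * (Z.submatrix f id).det) := by
  rw [Matrix.mul_assoc, factorial_mul_det_transpose_mul]
  refine Finset.sum_congr rfl fun f _ => ?_
  have : (diagonal w * Z).submatrix f id = diagonal (fun i => w (f i)) * Z.submatrix f id := by
    ext i l
    simp [Matrix.diagonal_mul]
  rw [this, Matrix.det_mul, Matrix.det_diagonal]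
  ring

/-- Cauchy–Schwarz inequality for determinants of weighted Gram matrices. -/
theorem det_weighted_sq_le (w : Fin n → ℝ) (hw : ∀ i, 0 ≤ w i)
    (Y Z : Matrix (Fin n) (Fin j) ℝ) :
    (Yᵀ * diagonal w * Z).det ^ 2 ≤ (Yᵀ * diagonal w * Y).det * (Zᵀ * diagonal w * Z).det := by
  have hj : (0 : ℝ) < j.factorial := by exact_mod_cast j.factorial_pos
  have hp : ∀ f : Fin j → Fin n, 0 ≤ ∏ i, w (f i) := fun f => Finset.prod_nonneg fun i _ => hw _
  have key : ((j.factorial : ℝ) * (Yᵀ * diagonal w * Z).det) ^ 2 ≤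
      ((j.factorial : ℝ) * (Yᵀ * diagonal w * Y).det) *
        ((j.factorial : ℝ) * (Zᵀ * diagonal w * Z).det) := by
    simp only [factorial_mul_det_weighted]
    refine Finset.sum_sq_le_sum_mul_sum_of_sq_le_mul _ (fun f _ => ?_) (fun f _ => ?_)
      (fun f _ => ?_)
    · exact mul_nonneg (hp f) (mul_self_nonneg _)
    · exact mul_nonneg (hp f) (mul_self_nonneg _)
    · exact le_of_eq (by ring)
  have h2 : (0 : ℝ) < (j.factorial : ℝ) ^ 2 := by positivity
  refine le_of_mul_le_mul_left ?_ h2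
  calc _ = ((j.factorial : ℝ) * (Yᵀ * diagonal w * Z).det) ^ 2 := by ring
    _ ≤ _ := key
    _ = _ := by ring

theorem det_transpose_mul_sq_le (Y Z : Matrix (Fin n) (Fin j) ℝ) :
    (Yᵀ * Z).det ^ 2 ≤ (Yᵀ * Y).det * (Zᵀ * Z).det := by
  simpa using det_weighted_sq_le (fun _ => (1 : ℝ)) (fun _ => zero_le_one) Y Z

theorem castLE_le_orderEmbOfFin {I : Finset (Fin n)} (hcard : I.card = j) (hj : j ≤ n)
    (i : Fin j) : Fin.castLE hj i ≤ I.orderEmbOfFin hcard i := by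
  rw [Fin.le_def]
  have : ∀ m (hm : m < j), m ≤ (I.orderEmbOfFin hcard ⟨m, hm⟩).val := by
    intro m
    induction m with
    | zero => intro _; exact Nat.zero_le _
    | succ m ih =>
      intro hm
      have := ih (by omega)
      have hlt : I.orderEmbOfFin hcard ⟨m, by omega⟩ < I.orderEmbOfFin hcard ⟨m + 1, hm⟩ :=
        (I.orderEmbOfFin hcard).strictMono (by simp [Fin.lt_def])
      rw [Fin.lt_def] at hlt
      omega
  exact this i.val i.isLt

theorem prod_castLE_le_prod_of_injective {w : Fin n → ℝ} (hw : ∀ i, 0 ≤ w i) (hm : Monotone w)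
    (hj : j ≤ n) {f : Fin j → Fin n} (hf : Function.Injective f) :
    ∏ i : Fin j, w (Fin.castLE hj i) ≤ ∏ i, w (f i) := by
  classical
  set I : Finset (Fin n) := Finset.univ.image f with hI
  have hcard : I.card = j := by
    rw [hI, Finset.card_image_of_injective _ hf]; simp
  have h1 : ∏ i, w (f i) = ∏ a ∈ I, w a := by
    rw [hI, Finset.prod_image fun a _ b _ h => hf h]
  have h2 : ∏ a ∈ I, w a = ∏ i : Fin j, w (I.orderEmbOfFin hcard i) := by
    rw [← Finset.prod_image (s := Finset.univ) (g := fun i => I.orderEmbOfFin hcard i)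
      (fun a _ b _ h => (I.orderEmbOfFin hcard).injective h), Finset.image_orderEmbOfFin_univ]
  rw [h1, h2]
  refine Finset.prod_le_prod (fun i _ => hw _) fun i _ => hm ?_
  exact castLE_le_orderEmbOfFin hcard hj i

theorem prod_le_prod_rev_castLE_of_injective {w : Fin n → ℝ} (hw : ∀ i, 0 ≤ w i)
    (hm : Monotone w) (hj : j ≤ n) {f : Fin j → Fin n} (hf : Function.Injective f) :
    ∏ i, w (f i) ≤ ∏ i : Fin j, w (Fin.rev (Fin.castLE hj i)) := by
  classical
  set I : Finset (Fin n) := Finset.univ.image (Fin.rev ∘ f) with hI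
  have hf' : Function.Injective (Fin.rev ∘ f) := Fin.rev_injective.comp hf
  have hcard : I.card = j := by
    rw [hI, Finset.card_image_of_injective _ hf']; simp
  have h1 : ∏ i, w (f i) = ∏ a ∈ I, w a.rev := by
    rw [hI, Finset.prod_image fun a _ b _ h => hf' h]
    simp
  have h2 : ∏ a ∈ I, w a.rev = ∏ i : Fin j, w (I.orderEmbOfFin hcard i).rev := by
    rw [← Finset.prod_image (s := Finset.univ) (g := fun i => I.orderEmbOfFin hcard i)
      (f := fun a => w a.rev)
      (fun a _ b _ h => (I.orderEmbOfFin hcard).injective h), Finset.image_orderEmbOfFin_univ]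
  rw [h1, h2]
  refine Finset.prod_le_prod (fun i _ => hw _) fun i _ => hm ?_
  rw [Fin.rev_le_rev]
  exact castLE_le_orderEmbOfFin hcard hj i

theorem det_submatrix_eq_zero_of_not_injective (Y : Matrix (Fin n) (Fin j) ℝ)
    {f : Fin j → Fin n} (hf : ¬ Function.Injective f) : (Y.submatrix f id).det = 0 := by
  simp only [Function.Injective, not_forall] at hf
  obtain ⟨a, b, hab, hne⟩ := hf
  exact Matrix.det_zero_of_row_eq hne (by ext l; simp [hab])

/-- The determinant of a weighted Gram matrix is at least the product of the smallest weights
times the determinant of the Gram matrix. -/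
theorem prod_castLE_mul_det_le {w : Fin n → ℝ} (hw : ∀ i, 0 ≤ w i) (hm : Monotone w)
    (hj : j ≤ n) (Y : Matrix (Fin n) (Fin j) ℝ) :
    (∏ i : Fin j, w (Fin.castLE hj i)) * (Yᵀ * Y).det ≤ (Yᵀ * diagonal w * Y).det := by
  have hfac : (0 : ℝ) < j.factorial := by exact_mod_cast j.factorial_pos
  refine le_of_mul_le_mul_left ?_ hfac
  rw [factorial_mul_det_weighted, mul_left_comm, factorial_mul_det_transpose_mul, Finset.mul_sum]
  refine Finset.sum_le_sum fun f _ => ?_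
  by_cases hf : Function.Injective f
  · exact mul_le_mul_of_nonneg_right (prod_castLE_le_prod_of_injective hw hm hj hf)
      (mul_self_nonneg _)
  · simp [det_submatrix_eq_zero_of_not_injective Y hf]

/-- The determinant of a weighted Gram matrix is at most the product of the largest weights
times the determinant of the Gram matrix. -/
theorem det_le_prod_rev_mul_det {w : Fin n → ℝ} (hw : ∀ i, 0 ≤ w i) (hm : Monotone w)
    (hj : j ≤ n) (Y : Matrix (Fin n) (Fin j) ℝ) :
    (Yᵀ * diagonal w * Y).det ≤
      (∏ i : Fin j, w (Fin.rev (Fin.castLE hj i))) * (Yᵀ * Y).det := by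
  have hfac : (0 : ℝ) < j.factorial := by exact_mod_cast j.factorial_pos
  refine le_of_mul_le_mul_left ?_ hfac
  rw [factorial_mul_det_weighted, mul_left_comm, factorial_mul_det_transpose_mul, Finset.mul_sum]
  refine Finset.sum_le_sum fun f _ => ?_
  by_cases hf : Function.Injective f
  · exact mul_le_mul_of_nonneg_right (prod_le_prod_rev_castLE_of_injective hw hm hj hf)
      (mul_self_nonneg _)
  · simp [det_submatrix_eq_zero_of_not_injective Y hf]

/-- With `c = cos θ` and `t = sin θ`, `2c(sc + t) = s + s cos 2θ + sin 2θ`. This is largest when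
`(cos 2θ, sin 2θ)` points along `(s, 1)`, which is the angle chosen. -/
theorem exists_rotation (s : ℝ) : ∃ c t : ℝ, c ^ 2 + t ^ 2 = 1 ∧
    2 * (c * (s * c + t)) = s + √(1 + s ^ 2) := by
  set q := √(1 + s ^ 2) with hq
  have hq2 : q ^ 2 = 1 + s ^ 2 := Real.sq_sqrt (by positivity)
  have hqpos : 0 < q := Real.sqrt_pos.2 (by positivity)
  have hlt : 0 < 1 + s / q := by
    have : -q < s := (abs_lt.1 (abs_lt_of_sq_lt_sq
      (show s ^ 2 < q ^ 2 by rw [hq2]; linarith) hqpos.le)).1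
    rw [show 1 + s / q = (q + s) / q by field_simp]
    exact div_pos (by linarith) hqpos
  set c := √((1 + s / q) / 2) with hc
  have hc2 : c ^ 2 = (1 + s / q) / 2 := Real.sq_sqrt (by positivity)
  have hcpos : 0 < c := Real.sqrt_pos.2 (by positivity)
  have ht : c * (1 / (2 * c * q)) = 1 / (2 * q) := by field_simp
  refine ⟨c, 1 / (2 * c * q), ?_, ?_⟩
  · have : (1 / (2 * c * q)) ^ 2 = 1 / (4 * c ^ 2 * q ^ 2) := by field_simp; norm_num
    rw [this, hc2]
    field_simp
    have h0 : q + s ≠ 0 := by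
      intro h
      have : 1 + s / q = (q + s) / q := by field_simp
      rw [this, h] at hlt; simp at hlt
    field_simp
    nlinarith
  · rw [mul_add, ht, show c * (s * c) = s * c ^ 2 by ring, hc2]
    field_simp
    nlinarith

/-- Log-majorisation of the tangents `s i` of the angles between a subspace and its image under
the inverse of `diagonal w`. -/
theorem prod_castLE_mul_prod_sq_le_prod_rev {w : Fin n → ℝ} (hw : ∀ i, 0 < w i)
    (hm : Monotone w) (hj : j ≤ n) (e b : Matrix (Fin n) (Fin j) ℝ) (s : Fin j → ℝ)
    (hs : ∀ i, 0 ≤ s i) (hee : eᵀ * e = 1) (hbb : bᵀ * b = 1) (heb : eᵀ * b = 0)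
    (horth : bᵀ * diagonal w * (e + b * diagonal s) = 0) :
    (∏ i : Fin j, w (Fin.castLE hj i)) * ∏ i, (s i + √(1 + s i ^ 2)) ^ 2 ≤
      ∏ i : Fin j, w (Fin.rev (Fin.castLE hj i)) := by
  have hw0 : ∀ i, 0 ≤ w i := fun i => (hw i).le
  have hbe : bᵀ * e = 0 := by
    have := congrArg Matrix.transpose heb
    simpa using this
  -- In the plane of each pair `e_i, b_i` a rotation is chosen so that `2 c_i v_i = s_i + √(1 +
  -- s_i²)`.
  choose c t hct hmax using fun i => exists_rotation (s i)
  set v : Fin j → ℝ := fun i => s i * c i + t i with hv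
  set h := e + b * diagonal s with hh
  set W := (diagonal w : Matrix (Fin n) (Fin n) ℝ) with hW
  have hWt : Wᵀ = W := Matrix.diagonal_transpose _
  have horth' : hᵀ * W * b = 0 := by
    have := congrArg Matrix.transpose horth
    simpa [hWt, Matrix.mul_assoc] using this
  set lo := ∏ i : Fin j, w (Fin.castLE hj i) with hlo
  have hlopos : 0 < lo := Finset.prod_pos fun i _ => hw _
  set A := hᵀ * W * h with hA
  set D := bᵀ * W * b with hD
  set C := (diagonal c : Matrix (Fin j) (Fin j) ℝ) with hC
  set V := (diagonal v : Matrix (Fin j) (Fin j) ℝ) with hV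
  set T := (diagonal t : Matrix (Fin j) (Fin j) ℝ) with hT
  set S := (diagonal s : Matrix (Fin j) (Fin j) ℝ) with hS
  have hCt : Cᵀ = C := Matrix.diagonal_transpose _
  have hVt : Vᵀ = V := Matrix.diagonal_transpose _
  have hTt : Tᵀ = T := Matrix.diagonal_transpose _
  have hAt : Aᵀ = A := by simp [hA, hWt, Matrix.mul_assoc]
  have hDt : Dᵀ = D := by simp [hD, hWt, Matrix.mul_assoc]
  have hVC : V = S * C + T := by
    ext i l
    by_cases hil : i = l
    · subst hil; simp [hV, hS, hC, hT, hv]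
    · simp [hV, hS, hC, hT, hv, hil]
  have hSCcomm : S * C = C * S := by simp [hC, hS, Matrix.diagonal_mul_diagonal, mul_comm]
  have hVCcomm : V * C = C * V := by simp [hC, hV, Matrix.diagonal_mul_diagonal, mul_comm]
  have hCT1 : C * C + T * T = 1 := by
    ext i l
    by_cases hil : i = l
    · subst hil
      have := hct i
      simp only [sq] at this
      simp [hC, hT, this]
    · simp [hC, hT, hil]
  have hdetA : 0 < A.det := by
    have h1 := prod_castLE_mul_det_le hw0 hm hj h
    -- Since `eᵀ h = 1` and `eᵀ e = 1`, Cauchy–Schwarz for determinants bounds `det (hᵀ h)` from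
    -- below.
    have h2 : (1 : ℝ) ≤ (hᵀ * h).det := by
      have := det_transpose_mul_sq_le e h
      rw [hee] at this
      simpa [hh, Matrix.mul_add, ← Matrix.mul_assoc, hee, heb] using this
    nlinarith
  have hdetD : 0 < D.det := by
    have h1 := prod_castLE_mul_det_le hw0 hm hj b
    rw [hbb, Matrix.det_one, mul_one] at h1
    exact hlopos.trans_le h1
  have hcv : ∀ i, 0 < c i * v i := fun i => by
    have : 0 < s i + √(1 + s i ^ 2) :=
      add_pos_of_nonneg_of_pos (hs i) (Real.sqrt_pos.2 (by positivity))
    rw [← hmax i] at this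
    simpa using this
  have hdetC : C.det ≠ 0 := by
    rw [hC, Matrix.det_diagonal, Finset.prod_ne_zero_iff]
    exact fun i _ h0 => by
      have := hcv i
      simp [h0] at this
  have hdetV : V.det ≠ 0 := by
    rw [hV, Matrix.det_diagonal, Finset.prod_ne_zero_iff]
    exact fun i _ h0 => by
      have := hcv i
      simp [h0] at this
  set P := C * A * C with hP
  set Q := V * D * V with hQ
  have hPu : IsUnit P.det := by
    rw [isUnit_iff_ne_zero, hP, Matrix.det_mul, Matrix.det_mul]
    exact mul_ne_zero (mul_ne_zero hdetC hdetA.ne') hdetC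
  have hQu : IsUnit Q.det := by
    rw [isUnit_iff_ne_zero, hQ, Matrix.det_mul, Matrix.det_mul]
    exact mul_ne_zero (mul_ne_zero hdetV hdetD.ne') hdetV
  have hPt : (P⁻¹)ᵀ = P⁻¹ := by
    rw [Matrix.transpose_nonsing_inv]; simp [hP, hAt, hCt, Matrix.mul_assoc]
  have hQt : (Q⁻¹)ᵀ = Q⁻¹ := by
    rw [Matrix.transpose_nonsing_inv]; simp [hQ, hDt, hVt, Matrix.mul_assoc]
  -- Gram matrix of two combinations of the `W`-orthogonal families `h` and `b`
  have hgram : ∀ a₁ a₂ b₁ b₂ : Matrix (Fin j) (Fin j) ℝ,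
      (h * a₁ + b * b₁)ᵀ * W * (h * a₂ + b * b₂) = a₁ᵀ * A * a₂ + b₁ᵀ * D * b₂ := by
    intro a₁ a₂ b₁ b₂
    calc _ = a₁ᵀ * (hᵀ * W * h) * a₂ + a₁ᵀ * (hᵀ * W * b) * b₂ + b₁ᵀ * (bᵀ * W * h) * a₂
          + b₁ᵀ * (bᵀ * W * b) * b₂ := by
          simp only [Matrix.transpose_add, Matrix.transpose_mul, Matrix.add_mul, Matrix.mul_add,
            Matrix.mul_assoc]
          abel
      _ = _ := by rw [horth, horth']; simp [hA, hD]
  -- `x` is the rotated orthonormal family `eC - bT`; expressed through the `W`-orthogonal families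
  -- `h` and `b`, its weighted Gram matrix splits as `P + Q`.
  set x := h * C + b * (-V) with hx
  have hxe : x = e * C + b * (-T) := by
    rw [hx, hh, hVC, Matrix.add_mul, Matrix.mul_assoc, Matrix.mul_neg, Matrix.mul_neg,
      Matrix.mul_add]
    abel
  have hxx : xᵀ * x = 1 := by
    calc xᵀ * x = C * (eᵀ * e) * C - C * (eᵀ * b) * T - T * (bᵀ * e) * C + T * (bᵀ * b) * T := by
          rw [hxe]
          simp only [Matrix.transpose_add, Matrix.transpose_mul, Matrix.transpose_neg, hCt, hTt,
            Matrix.add_mul, Matrix.mul_add, Matrix.mul_neg, Matrix.neg_mul, Matrix.mul_assoc]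
          abel
      _ = 1 := by rw [hee, hbb, heb, hbe]; simpa using hCT1
  set y := e * T + b * C with hy
  have hyy : yᵀ * y = 1 := by
    calc yᵀ * y = T * (eᵀ * e) * T + T * (eᵀ * b) * C + C * (bᵀ * e) * T + C * (bᵀ * b) * C := by
          rw [hy]
          simp only [Matrix.transpose_add, Matrix.transpose_mul, hCt, hTt,
            Matrix.add_mul, Matrix.mul_add, Matrix.mul_assoc]
          abel
      _ = 1 := by rw [hee, hbb, heb, hbe]; simpa [add_comm] using hCT1
  have hxW : xᵀ * W * x = P + Q := by
    rw [hx, hgram]; simp [hCt, hVt, hP, hQ]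
  -- `z` is chosen so that `xᵀ W z = 2`. Changing the sign of its `b` part gives `y'`, which has the
  -- same weighted Gram matrix but a computable unweighted product with the orthonormal family `y`.
  set z := h * (C * P⁻¹) + b * (-(V * Q⁻¹)) with hz
  set y' := h * (C * P⁻¹) + b * (V * Q⁻¹) with hy'
  have hPinv : (C * P⁻¹)ᵀ * A * (C * P⁻¹) = P⁻¹ := by
    calc _ = P⁻¹ * P * P⁻¹ := by
          rw [Matrix.transpose_mul, hPt, hCt]; simp only [hP, Matrix.mul_assoc]
      _ = _ := by rw [Matrix.nonsing_inv_mul _ hPu, Matrix.one_mul]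
  have hQinv : (V * Q⁻¹)ᵀ * D * (V * Q⁻¹) = Q⁻¹ := by
    calc _ = Q⁻¹ * Q * Q⁻¹ := by
          rw [Matrix.transpose_mul, hQt, hVt]; simp only [hQ, Matrix.mul_assoc]
      _ = _ := by rw [Matrix.nonsing_inv_mul _ hQu, Matrix.one_mul]
  have hzW : zᵀ * W * z = P⁻¹ + Q⁻¹ := by
    rw [hz, hgram, Matrix.transpose_neg, Matrix.neg_mul, Matrix.neg_mul, Matrix.mul_neg, neg_neg,
      hPinv, hQinv]
  have hy'W : y'ᵀ * W * y' = P⁻¹ + Q⁻¹ := by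
    rw [hy', hgram, hPinv, hQinv]
  have hxz : xᵀ * W * z = (2 : ℝ) • (1 : Matrix (Fin j) (Fin j) ℝ) := by
    have h1 : xᵀ * W * z = P * P⁻¹ + Q * Q⁻¹ := by
      rw [hx, hz, hgram]
      simp [hCt, hVt, hP, hQ, Matrix.mul_assoc]
    rw [h1, Matrix.mul_nonsing_inv _ hPu, Matrix.mul_nonsing_inv _ hQu, two_smul]
  have hyy' : yᵀ * y' = C * V * (P⁻¹ + Q⁻¹) := by
    have hyh : yᵀ * h = V := by
      calc yᵀ * h = T * (eᵀ * e) + T * (eᵀ * b) * S + C * (bᵀ * e) + C * (bᵀ * b) * S := by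
            rw [hy, hh]
            simp only [Matrix.transpose_add, Matrix.transpose_mul, hCt, hTt,
              Matrix.add_mul, Matrix.mul_add, Matrix.mul_assoc]
            abel
        _ = V := by rw [hee, hbb, heb, hbe, hVC, hSCcomm]; simp [add_comm]
    have hyb : yᵀ * b = C := by
      calc yᵀ * b = T * (eᵀ * b) + C * (bᵀ * b) := by
            rw [hy]
            simp only [Matrix.transpose_add, Matrix.transpose_mul, hCt, hTt,
              Matrix.add_mul, Matrix.mul_assoc]
        _ = C := by rw [hbb, heb]; simp
    calc yᵀ * y' = (yᵀ * h) * (C * P⁻¹) + (yᵀ * b) * (V * Q⁻¹) := by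
          rw [hy', Matrix.mul_add, ← Matrix.mul_assoc, ← Matrix.mul_assoc]
          simp only [Matrix.mul_assoc]
      _ = _ := by rw [hyh, hyb, Matrix.mul_add, ← Matrix.mul_assoc, ← Matrix.mul_assoc, hVCcomm]
  set p := (P + Q).det with hp
  set g := (P⁻¹ + Q⁻¹).det with hg
  have hup : p ≤ ∏ i : Fin j, w (Fin.rev (Fin.castLE hj i)) := by
    have := det_le_prod_rev_mul_det hw0 hm hj x
    rwa [hxx, hxW, Matrix.det_one, mul_one] at this
  have hppos : 0 < p := by
    have := prod_castLE_mul_det_le hw0 hm hj x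
    rw [hxx, hxW, Matrix.det_one, mul_one] at this
    exact hlopos.trans_le this
  have hcs : ((2 : ℝ) ^ j) ^ 2 ≤ p * g := by
    have := det_weighted_sq_le w hw0 x z
    rw [hxz, hxW, hzW, Matrix.det_smul] at this
    simpa using this
  have hgpos : 0 < g := by
    have : 0 < p * g := lt_of_lt_of_le (by positivity) hcs
    exact (mul_pos_iff_of_pos_left hppos).1 this
  -- The smallest weights bound `det (y'ᵀ W y') = g` below by `lo · det (y'ᵀ y')`, and
  -- Cauchy–Schwarz against `y` bounds `det (y'ᵀ y')` below.
  have hlow : lo * ((C.det * V.det) ^ 2 * g) ≤ 1 := by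
    have h1 := prod_castLE_mul_det_le hw0 hm hj y'
    have h2 := det_transpose_mul_sq_le y y'
    rw [hyy, hyy', Matrix.det_mul, Matrix.det_mul, Matrix.det_one, one_mul] at h2
    rw [hy'W] at h1
    have h3 : lo * ((C.det * V.det * g) ^ 2) ≤ g :=
      (mul_le_mul_of_nonneg_left h2 hlopos.le).trans h1
    have h4 : (lo * ((C.det * V.det) ^ 2 * g)) * g ≤ 1 * g := by
      calc _ = lo * ((C.det * V.det * g) ^ 2) := by ring
        _ ≤ _ := by simpa using h3
    exact le_of_mul_le_mul_right h4 hgpos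
  have hprod : ∏ i, (s i + √(1 + s i ^ 2)) ^ 2 = ((2 : ℝ) ^ j) ^ 2 * (C.det * V.det) ^ 2 := by
    rw [hC, hV, Matrix.det_diagonal, Matrix.det_diagonal, ← Finset.prod_mul_distrib, ← mul_pow,
      Finset.prod_pow]
    congr 1
    have : (2 : ℝ) ^ j = ∏ _i : Fin j, (2 : ℝ) := by simp
    rw [this, ← Finset.prod_mul_distrib]
    exact Finset.prod_congr rfl fun i _ => (hmax i).symm
  rw [hprod]
  calc lo * (((2 : ℝ) ^ j) ^ 2 * (C.det * V.det) ^ 2)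
      ≤ lo * ((p * g) * (C.det * V.det) ^ 2) := by gcongr
    _ = p * (lo * ((C.det * V.det) ^ 2 * g)) := by ring
    _ ≤ p * 1 := by gcongr
    _ ≤ _ := by rw [mul_one]; exact hup

end Determinants

/-! ### The function `ω` and weak log-majorisation. -/

section Majorization

theorem omegaK_eq {x : ℝ} (hx : 0 < x) : omegaK x = (x + 2 + 1 / x) / 4 := by
  have h : √x ≠ 0 := (Real.sqrt_pos.2 hx).ne'
  have h2 : √x ^ 2 = x := Real.sq_sqrt hx.le
  rw [omegaK, add_sq, div_pow, h2]
  field_simp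

/-- In logarithmic coordinates `ω` is convex, and increasing for `t ≥ 0`, which is what majorisation
uses. -/
theorem omegaK_exp (t : ℝ) : omegaK (Real.exp t) = (1 + Real.cosh t) / 2 := by
  rw [omegaK_eq (Real.exp_pos t), Real.cosh_eq, Real.exp_neg]
  field_simp
  ring

theorem one_le_omegaK {x : ℝ} (hx : 0 < x) : 1 ≤ omegaK x := by
  rw [← Real.exp_log hx, omegaK_exp]
  linarith [Real.one_le_cosh (Real.log x)]

theorem omegaK_one : omegaK 1 = 1 := by
  rw [omegaK_eq one_pos]
  norm_num

theorem omegaK_mono {x y : ℝ} (hx : 1 ≤ x) (hxy : x ≤ y) : omegaK x ≤ omegaK y := by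
  have h0 : 0 < x := by linarith
  have h1 : 0 < y := by linarith
  rw [← Real.exp_log h0, ← Real.exp_log h1, omegaK_exp, omegaK_exp]
  have h2 : Real.log x ≤ Real.log y := Real.log_le_log h0 hxy
  have h3 : 0 ≤ Real.log x := Real.log_nonneg hx
  have : Real.cosh (Real.log x) ≤ Real.cosh (Real.log y) := by
    rw [Real.cosh_le_cosh, abs_of_nonneg h3, abs_of_nonneg (h3.trans h2)]
    exact h2
  linarith

theorem one_le_add_sqrt_sq {s : ℝ} (hs : 0 ≤ s) : 1 ≤ (s + √(1 + s ^ 2)) ^ 2 := by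
  have h : 1 ≤ √(1 + s ^ 2) := by
    rw [Real.one_le_sqrt]
    nlinarith [sq_nonneg s]
  nlinarith

/-- With `s = sinh t` the argument is `exp (2t)` and the value is `cosh² t`. -/
theorem omegaK_add_sqrt_sq {s : ℝ} (hs : 0 ≤ s) :
    omegaK ((s + √(1 + s ^ 2)) ^ 2) = 1 + s ^ 2 := by
  set q := √(1 + s ^ 2) with hq
  have hq2 : q ^ 2 = 1 + s ^ 2 := Real.sq_sqrt (by positivity)
  have h1 := one_le_add_sqrt_sq hs
  rw [omegaK_eq (by linarith)]
  have hinv : 1 / (s + q) ^ 2 = (q - s) ^ 2 := by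
    have hpos : (s + q) ^ 2 ≠ 0 := by intro h; rw [← hq, h] at h1; linarith
    rw [div_eq_iff hpos, ← mul_pow]
    have : (q - s) * (s + q) = 1 := by nlinarith
    rw [this, one_pow]
  rw [hinv]
  nlinarith

/-- Tangent line of the convex function `cosh`, from `1 + u ≤ exp u` applied to both exponentials.
-/
theorem add_sinh_mul_le_cosh (x y : ℝ) :
    Real.cosh x + Real.sinh x * (y - x) ≤ Real.cosh y := by
  have h1 : Real.exp x * (1 + (y - x)) ≤ Real.exp y := by
    calc _ ≤ Real.exp x * Real.exp (y - x) := by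
          gcongr
          linarith [Real.add_one_le_exp (y - x)]
      _ = _ := by rw [← Real.exp_add]; ring_nf
  have h2 : Real.exp (-x) * (1 - (y - x)) ≤ Real.exp (-y) := by
    calc _ ≤ Real.exp (-x) * Real.exp (-(y - x)) := by
          gcongr
          linarith [Real.add_one_le_exp (-(y - x))]
      _ = _ := by rw [← Real.exp_add]; ring_nf
  rw [Real.cosh_eq, Real.cosh_eq, Real.sinh_eq]
  linarith

/-- Abel summation. -/
theorem sum_mul_nonneg_of_antitone {p : ℕ} {c d : ℕ → ℝ}
    (hc : ∀ i j, i ≤ j → j < p → c j ≤ c i) (hc0 : ∀ i < p, 0 ≤ c i)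
    (hd : ∀ j ≤ p, 0 ≤ ∑ i ∈ Finset.range j, d i) :
    0 ≤ ∑ i ∈ Finset.range p, c i * d i := by
  have key : ∀ j < p, c j * ∑ i ∈ Finset.range (j + 1), d i ≤
      ∑ i ∈ Finset.range (j + 1), c i * d i := by
    intro j
    induction j with
    | zero => intro _; simp
    | succ j ih =>
      intro hj
      rw [Finset.sum_range_succ, Finset.sum_range_succ _ (j + 1), mul_add]
      have h1 := ih (by omega)
      have h2 := mul_le_mul_of_nonneg_right (hc j (j + 1) (by omega) hj) (hd (j + 1) (by omega))
      linarith
  rcases p with _ | p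
  · simp
  · exact (mul_nonneg (hc0 p (by omega)) (hd _ le_rfl)).trans (key p (by omega))

/-- `omegaK` respects weak log-majorisation. -/
theorem sum_omegaK_le_of_prod_le {p : ℕ} {a x : ℕ → ℝ} (ha : ∀ i < p, 1 ≤ a i)
    (hx : ∀ i < p, 1 ≤ x i) (hanti : ∀ i j, i ≤ j → j < p → a j ≤ a i)
    (hprod : ∀ j ≤ p, ∏ i ∈ Finset.range j, a i ≤ ∏ i ∈ Finset.range j, x i) :
    ∑ i ∈ Finset.range p, omegaK (a i) ≤ ∑ i ∈ Finset.range p, omegaK (x i) := by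
  have ha0 : ∀ i < p, 0 < a i := fun i hi => by linarith [ha i hi]
  have hx0 : ∀ i < p, 0 < x i := fun i hi => by linarith [hx i hi]
  -- The tangent slopes `sinh (log (a i))` are nonnegative and decreasing because `a` is sorted; `x`
  -- need not be.
  have h1 : 0 ≤ ∑ i ∈ Finset.range p,
      Real.sinh (Real.log (a i)) * (Real.log (x i) - Real.log (a i)) := by
    refine sum_mul_nonneg_of_antitone (fun i j hij hj => ?_) (fun i hi => ?_) fun j hj => ?_
    · exact Real.sinh_le_sinh.2 (Real.log_le_log (ha0 j hj) (hanti i j hij hj))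
    · exact Real.sinh_nonneg_iff.2 (Real.log_nonneg (ha i hi))
    · rw [Finset.sum_sub_distrib, sub_nonneg, ← Real.log_prod, ← Real.log_prod]
      · refine Real.log_le_log (Finset.prod_pos fun i hi => ha0 i ?_) (hprod j hj)
        have := Finset.mem_range.1 hi
        omega
      · intro i hi
        have := Finset.mem_range.1 hi
        exact (hx0 i (by omega)).ne'
      · intro i hi
        have := Finset.mem_range.1 hi
        exact (ha0 i (by omega)).ne'
  have h2 : ∀ i ∈ Finset.range p, omegaK (a i) +
      Real.sinh (Real.log (a i)) * (Real.log (x i) - Real.log (a i)) / 2 ≤ omegaK (x i) := by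
    intro i hi
    have hi' := Finset.mem_range.1 hi
    have h := add_sinh_mul_le_cosh (Real.log (a i)) (Real.log (x i))
    have e1 := omegaK_exp (Real.log (a i))
    have e2 := omegaK_exp (Real.log (x i))
    rw [Real.exp_log (ha0 i hi')] at e1
    rw [Real.exp_log (hx0 i hi')] at e2
    linarith
  have h3 := Finset.sum_le_sum h2
  rw [Finset.sum_add_distrib, ← Finset.sum_div] at h3
  linarith

end Majorization

/-! ### Matrix Kantorovich inequality in trace form. -/

section Tangents

open Matrix

/-- The basis diagonalises `T* T`, as in a singular value decomposition. -/
theorem exists_orthonormalBasis_image_orthogonal {V W : Type*} [NormedAddCommGroup V]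
    [InnerProductSpace ℝ V] [FiniteDimensional ℝ V] [NormedAddCommGroup W]
    [InnerProductSpace ℝ W] [FiniteDimensional ℝ W] {p : ℕ} (hp : Module.finrank ℝ V = p)
    (T : V →ₗ[ℝ] W) :
    ∃ (g : OrthonormalBasis (Fin p) ℝ V) (s : ℕ → ℝ), Antitone s ∧ (∀ i, 0 ≤ s i) ∧
      ∀ i l, inner ℝ (T (g i)) (T (g l)) = if i = l then s i ^ 2 else 0 := by
  have hS := T.isPositive_adjoint_comp_self.isSymmetric
  refine ⟨hS.eigenvectorBasis hp, T.singularValues, T.singularValues_antitone,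
    T.singularValues_nonneg, fun i l => ?_⟩
  rw [← LinearMap.adjoint_inner_left, ← LinearMap.comp_apply, hS.apply_eigenvectorBasis,
    inner_smul_left, (hS.eigenvectorBasis hp).inner_eq_ite, T.sq_singularValues_fin hp]
  split_ifs <;> simp

/-- Trace form of the matrix Kantorovich inequality: `ι` embeds `V` isometrically, and `ι + T` is
the graph parametrisation of the preimage of `ι V` under `diagonal w`. -/
theorem exists_basis_sum_one_add_sq_le {V : Type*} [NormedAddCommGroup V]
    [InnerProductSpace ℝ V] [FiniteDimensional ℝ V] {p n : ℕ} (hp : Module.finrank ℝ V = p)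
    (hpn : p ≤ n) {w : Fin n → ℝ} (hw : ∀ i, 0 < w i) (hm : Monotone w)
    (ι T : V →ₗ[ℝ] (Fin n → ℝ))
    (hι : ∀ g g' : V, ι g ⬝ᵥ ι g' = inner ℝ g g') (hιT : ∀ g g' : V, ι g ⬝ᵥ T g' = 0)
    (hT : ∀ g g' : V, T g ⬝ᵥ (diagonal w *ᵥ (ι g' + T g')) = 0) :
    ∃ (g : OrthonormalBasis (Fin p) ℝ V) (s : Fin p → ℝ), (∀ i, 0 ≤ s i) ∧
      (∀ i l, T (g i) ⬝ᵥ T (g l) = if i = l then s i ^ 2 else 0) ∧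
      (∑ i, (1 + s i ^ 2) ≤
        ∑ i : Fin p, omegaK (max 1 (w (Fin.rev (Fin.castLE hpn i)) / w (Fin.castLE hpn i)))) ∧
      ∀ (i : Fin p) (h0 : 0 < n), 1 + s i ^ 2 ≤ omegaK (w (Fin.rev ⟨0, h0⟩) / w ⟨0, h0⟩) := by
  obtain ⟨g, s, hanti, hs0, hs⟩ := exists_orthonormalBasis_image_orthogonal hp
    ((WithLp.linearEquiv 2 ℝ (Fin n → ℝ)).symm.toLinearMap ∘ₗ T)
  have hs' : ∀ i l, T (g i) ⬝ᵥ T (g l) = if i = l then s i ^ 2 else 0 := by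
    intro i l
    rw [← hs i l]
    simp [PiLp.inner_apply, dotProduct, mul_comm]
  -- The value `1` beyond `p` only serves to keep `1 ≤ x i` true for all `i`.
  set x : ℕ → ℝ := fun i => if h : i < p then
    max 1 (w (Fin.rev (Fin.castLE hpn ⟨i, h⟩)) / w (Fin.castLE hpn ⟨i, h⟩)) else 1 with hx
  set a : ℕ → ℝ := fun i => (s i + √(1 + s i ^ 2)) ^ 2 with ha
  have hstep : ∀ j (hj : j ≤ p), (∀ i < j, 0 < s i) →
      (∏ i : Fin j, w (Fin.castLE (hj.trans hpn) i)) * ∏ i ∈ Finset.range j, a i ≤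
        ∏ i : Fin j, w (Fin.rev (Fin.castLE (hj.trans hpn) i)) := by
    intro j hj hpos
    have hpos' : ∀ i : Fin j, s i ≠ 0 := fun i => (hpos i i.isLt).ne'
    set G : Fin j → V := fun i => g (Fin.castLE hj i) with hG
    have hTG : ∀ i l, T (G i) ⬝ᵥ T (G l) = if i = l then s i ^ 2 else 0 := by
      intro i l
      rw [hs']
      simp
    have hιG : ∀ i l, ι (G i) ⬝ᵥ ι (G l) = if i = l then 1 else 0 := by
      intro i l
      rw [hι, g.inner_eq_ite]
      simp
    have h := prod_castLE_mul_prod_sq_le_prod_rev hw hm (hj.trans hpn)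
      (Matrix.of fun r i => ι (G i) r) (Matrix.of fun r i => (s i)⁻¹ * T (G i) r)
      (fun i => s i) (fun i => hs0 i) ?_ ?_ ?_ ?_
    · rwa [Finset.prod_range]
    · ext i l
      rw [Matrix.one_apply, ← hιG i l]
      rfl
    · ext i l
      have : (((Matrix.of fun r (i : Fin j) => (s i)⁻¹ * T (G i) r)ᵀ *
          Matrix.of fun r (i : Fin j) => (s i)⁻¹ * T (G i) r) : Matrix _ _ ℝ) i l =
          (s i)⁻¹ * (s l)⁻¹ * (T (G i) ⬝ᵥ T (G l)) := by
        simp only [Matrix.mul_apply, dotProduct, Finset.mul_sum, Matrix.transpose_apply,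
          Matrix.of_apply]
        exact Finset.sum_congr rfl fun r _ => by ring
      rw [this, hTG, Matrix.one_apply]
      split_ifs with hil
      · subst hil
        have := hpos' i
        field_simp
      · simp
    · ext i l
      have : (((Matrix.of fun r (i : Fin j) => ι (G i) r)ᵀ *
          Matrix.of fun r (i : Fin j) => (s i)⁻¹ * T (G i) r) : Matrix _ _ ℝ) i l =
          (s l)⁻¹ * (ι (G i) ⬝ᵥ T (G l)) := by
        simp only [Matrix.mul_apply, dotProduct, Finset.mul_sum, Matrix.transpose_apply,
          Matrix.of_apply]
        exact Finset.sum_congr rfl fun r _ => by ring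
      rw [this, hιT]
      simp
    · have hcol : (Matrix.of fun r (i : Fin j) => ι (G i) r) +
          (Matrix.of fun r (i : Fin j) => (s i)⁻¹ * T (G i) r) * diagonal (fun i : Fin j => s i) =
          (Matrix.of fun r (i : Fin j) => (ι (G i) + T (G i)) r) := by
        ext r i
        have := hpos' i
        simp only [Matrix.add_apply, Matrix.mul_diagonal, Matrix.of_apply, Pi.add_apply]
        field_simp
      rw [hcol]
      ext i l
      have : ((Matrix.of fun r (i : Fin j) => (s i)⁻¹ * T (G i) r)ᵀ * diagonal w *
          (Matrix.of fun r (i : Fin j) => (ι (G i) + T (G i)) r) : Matrix _ _ ℝ) i l =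
          (s i)⁻¹ * (T (G i) ⬝ᵥ (diagonal w *ᵥ (ι (G l) + T (G l)))) := by
        simp only [Matrix.mul_assoc, Matrix.mul_apply (M := (Matrix.of _)ᵀ), dotProduct,
          Finset.mul_sum, Matrix.transpose_apply, Matrix.of_apply, Matrix.diagonal_mul,
          Matrix.mulVec_diagonal]
        exact Finset.sum_congr rfl fun r _ => by ring
      rw [this, hT]
      simp
  have ha1 : ∀ i, 1 ≤ a i := fun i => one_le_add_sqrt_sq (hs0 i)
  have hx1 : ∀ i, 1 ≤ x i := fun i => by
    simp only [hx]
    split_ifs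
    · exact le_max_left _ _
    · exact le_rfl
  have hprod : ∀ j ≤ p, ∏ i ∈ Finset.range j, a i ≤ ∏ i ∈ Finset.range j, x i := by
    intro j
    induction j with
    | zero => intro _; simp
    | succ j ih =>
      intro hj
      -- The vectors `T g_i / s_i` in `hstep` require `s_i ≠ 0`. If `s_j = 0` the new factor `a_j`
      -- is `1`; otherwise all earlier `s_i` are positive by monotonicity and the determinant bound
      -- applies.
      by_cases hz : s j = 0
      · rw [Finset.prod_range_succ, Finset.prod_range_succ]
        have : a j = 1 := by simp [ha, hz]
        rw [this]
        exact mul_le_mul (ih (by omega)) (hx1 j) zero_le_one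
          (Finset.prod_nonneg fun i _ => zero_le_one.trans (hx1 i))
      · have hpos : ∀ i < j + 1, 0 < s i := fun i hi =>
          (lt_of_le_of_ne (hs0 j) (Ne.symm hz)).trans_le (hanti (by omega))
        have h := hstep (j + 1) hj hpos
        have hlo : 0 < ∏ i : Fin (j + 1), w (Fin.castLE (hj.trans hpn) i) :=
          Finset.prod_pos fun i _ => hw _
        rw [mul_comm, ← le_div_iff₀ hlo, ← Finset.prod_div_distrib] at h
        refine h.trans ?_
        rw [Finset.prod_range]
        refine Finset.prod_le_prod (fun i _ => div_nonneg (hw _).le (hw _).le) fun i _ => ?_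
        have hi : i.val < p := by omega
        simp only [hx, hi, dif_pos]
        exact le_max_right _ _
  refine ⟨g, fun i => s i, fun i => hs0 i, fun i l => hs' i l, ?_, fun i h0 => ?_⟩
  · have h := sum_omegaK_le_of_prod_le (p := p) (fun i _ => ha1 i) (fun i _ => hx1 i)
      (fun i l hil _ => ?_) hprod
    · rw [Finset.sum_range, Finset.sum_range] at h
      refine le_trans (le_of_eq ?_) (h.trans (le_of_eq ?_))
      · exact Finset.sum_congr rfl fun i _ => (omegaK_add_sqrt_sq (hs0 i)).symm
      · exact Finset.sum_congr rfl fun i _ => by simp [hx]; rfl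
    · have hsl := hanti hil
      have := hs0 l
      simp only [ha]
      gcongr
  · have hp0 : 1 ≤ p := by have := i.isLt; omega
    have hratio : 1 ≤ w (Fin.rev ⟨0, h0⟩) / w ⟨0, h0⟩ := by
      rw [one_le_div (hw _)]
      exact hm (by simp [Fin.le_def])
    -- The case `j = 1` bounds the largest singular value, hence all of them.
    have h1 : a 0 ≤ w (Fin.rev ⟨0, h0⟩) / w ⟨0, h0⟩ := by
      have h := hprod 1 hp0
      rw [Finset.prod_range_one, Finset.prod_range_one] at h
      refine h.trans ?_
      have : 0 < p := hp0
      simp only [hx, this, dif_pos]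
      exact max_le hratio le_rfl
    have h2 : s i ^ 2 ≤ s 0 ^ 2 := by
      have := hanti (Nat.zero_le i.val)
      have := hs0 i
      gcongr
    have h3 := omegaK_mono (ha1 0) h1
    have h4 : omegaK (a 0) = 1 + s 0 ^ 2 := omegaK_add_sqrt_sq (hs0 0)
    simp only
    linarith

end Tangents

/-! ### Laplacian energy and the spectrum of a connected graph. -/

section Spectrum

open Matrix

namespace GraphSampling

variable {N : ℕ} (G : WeightedGraph N)

theorem WeightedGraph.laplacian_mulVec_apply (v : Fin N → ℝ) (i : Fin N) :
    (G.laplacian *ᵥ v) i = ∑ j, G.weight i j * (v i - v j) := by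
  rw [WeightedGraph.laplacian, Matrix.sub_mulVec, Pi.sub_apply, Matrix.mulVec_diagonal,
    Matrix.mulVec, dotProduct, Finset.sum_mul, ← Finset.sum_sub_distrib]
  exact Finset.sum_congr rfl fun j _ => by ring

theorem WeightedGraph.dotProduct_laplacian_mulVec (v : Fin N → ℝ) :
    v ⬝ᵥ (G.laplacian *ᵥ v) = (∑ i, ∑ j, G.weight i j * (v i - v j) ^ 2) / 2 := by
  have h1 : v ⬝ᵥ (G.laplacian *ᵥ v) = ∑ i, ∑ j, G.weight i j * (v i * (v i - v j)) := by
    simp only [dotProduct, G.laplacian_mulVec_apply, Finset.mul_sum]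
    exact Finset.sum_congr rfl fun i _ => Finset.sum_congr rfl fun j _ => by ring
  have h2 : v ⬝ᵥ (G.laplacian *ᵥ v) = ∑ i, ∑ j, G.weight i j * (v j * (v j - v i)) := by
    rw [h1, Finset.sum_comm]
    exact Finset.sum_congr rfl fun i _ => Finset.sum_congr rfl fun j _ => by rw [G.symm]
  have h3 : ∑ i, ∑ j, G.weight i j * (v i - v j) ^ 2 =
      v ⬝ᵥ (G.laplacian *ᵥ v) + v ⬝ᵥ (G.laplacian *ᵥ v) := by
    nth_rewrite 1 [h1]
    rw [h2, ← Finset.sum_add_distrib]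
    refine Finset.sum_congr rfl fun i _ => ?_
    rw [← Finset.sum_add_distrib]
    exact Finset.sum_congr rfl fun j _ => by ring
  rw [h3]
  ring

theorem WeightedGraph.dotProduct_laplacian_nonneg (v : Fin N → ℝ) :
    0 ≤ v ⬝ᵥ (G.laplacian *ᵥ v) := by
  rw [G.dotProduct_laplacian_mulVec]
  exact div_nonneg (Finset.sum_nonneg fun i _ => Finset.sum_nonneg fun j _ =>
    mul_nonneg (G.nonneg i j) (sq_nonneg _)) zero_le_two

theorem WeightedGraph.laplacian_transpose : G.laplacianᵀ = G.laplacian := by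
  rw [WeightedGraph.laplacian, Matrix.transpose_sub, Matrix.diagonal_transpose]
  congr 1
  ext i j
  exact G.symm j i

theorem WeightedGraph.eq_of_dotProduct_laplacian_eq_zero (hG : G.toSimpleGraph.Connected)
    {v : Fin N → ℝ} (hv : v ⬝ᵥ (G.laplacian *ᵥ v) = 0) (a b : Fin N) : v a = v b := by
  rw [G.dotProduct_laplacian_mulVec] at hv
  have hnn : ∀ i j, 0 ≤ G.weight i j * (v i - v j) ^ 2 :=
    fun i j => mul_nonneg (G.nonneg i j) (sq_nonneg _)
  have h0 : ∑ i, ∑ j, G.weight i j * (v i - v j) ^ 2 = 0 := by linarith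
  rw [Finset.sum_eq_zero_iff_of_nonneg fun i _ => Finset.sum_nonneg fun j _ => hnn i j] at h0
  have hadj : ∀ i j, G.toSimpleGraph.Adj i j → v i = v j := by
    intro i j hij
    have h1 := h0 i (Finset.mem_univ _)
    rw [Finset.sum_eq_zero_iff_of_nonneg fun j _ => hnn i j] at h1
    have h2 := h1 j (Finset.mem_univ _)
    have hij' : 0 < G.weight i j := hij
    rcases mul_eq_zero.1 h2 with h3 | h3
    · exact absurd h3 hij'.ne'
    · exact sub_eq_zero.1 (pow_eq_zero_iff two_ne_zero |>.1 h3)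
  obtain ⟨p⟩ := hG.preconnected a b
  induction p with
  | nil => rfl
  | cons h _ ih => exact (hadj _ _ h).trans ih

/-- A vector with vanishing Dirichlet energy that vanishes somewhere is zero. -/
theorem WeightedGraph.eq_zero_of_dotProduct_laplacian_eq_zero (hG : G.toSimpleGraph.Connected)
    {v : Fin N → ℝ} (hv : v ⬝ᵥ (G.laplacian *ᵥ v) = 0) {a : Fin N} (ha : v a = 0) : v = 0 :=
  funext fun b => (G.eq_of_dotProduct_laplacian_eq_zero hG hv b a).trans ha

theorem IsEigendecomposition.mulVec_col {L U : Matrix (Fin N) (Fin N) ℝ} {lam : Fin N → ℝ}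
    (hU : IsEigendecomposition L U lam) (i : Fin N) : L *ᵥ U.col i = lam i • U.col i := by
  have h1 : Uᵀ * U = 1 := (Matrix.mem_orthogonalGroup_iff' (Fin N) ℝ).1 hU.orthogonal
  have h2 : L * U = U * diagonal lam := by
    rw [hU.decomp, Matrix.mul_assoc, h1, Matrix.mul_one]
  ext a
  have h3 := congrFun (congrFun h2 a) i
  rw [Matrix.mul_diagonal] at h3
  simpa [Matrix.mulVec, dotProduct, Matrix.mul_apply, mul_comm] using h3

theorem IsEigendecomposition.col_dotProduct_col {L U : Matrix (Fin N) (Fin N) ℝ}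
    {lam : Fin N → ℝ} (hU : IsEigendecomposition L U lam) (i l : Fin N) :
    U.col i ⬝ᵥ U.col l = if i = l then 1 else 0 := by
  have h1 : Uᵀ * U = 1 := (Matrix.mem_orthogonalGroup_iff' (Fin N) ℝ).1 hU.orthogonal
  have h2 := congrFun (congrFun h1 i) l
  rw [Matrix.one_apply] at h2
  exact h2

theorem IsEigendecomposition.row_dotProduct_row {L U : Matrix (Fin N) (Fin N) ℝ}
    {lam : Fin N → ℝ} (hU : IsEigendecomposition L U lam) (a b : Fin N) :
    ∑ i, U a i * U b i = if a = b then 1 else 0 := by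
  have h1 : U * Uᵀ = 1 := (Matrix.mem_orthogonalGroup_iff (Fin N) ℝ).1 hU.orthogonal
  have h2 := congrFun (congrFun h1 a) b
  rw [Matrix.one_apply] at h2
  exact h2

theorem IsEigendecomposition.col_const_of_eq_zero {G : WeightedGraph N}
    {U : Matrix (Fin N) (Fin N) ℝ} {lam : Fin N → ℝ} (hG : G.toSimpleGraph.Connected)
    (hU : IsEigendecomposition G.laplacian U lam) {i : Fin N} (hi : lam i = 0) (a b : Fin N) :
    U a i = U b i :=
  G.eq_of_dotProduct_laplacian_eq_zero hG (v := U.col i)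
    (by rw [hU.mulVec_col, hi, zero_smul, dotProduct_zero]) a b

theorem WeightedGraph.laplacian_mulVec_one : G.laplacian *ᵥ 1 = 0 := by
  ext i
  simp [G.laplacian_mulVec_apply]

theorem IsEigendecomposition.eigenvalue_nonneg {G : WeightedGraph N}
    {U : Matrix (Fin N) (Fin N) ℝ} {lam : Fin N → ℝ}
    (hU : IsEigendecomposition G.laplacian U lam) (i : Fin N) : 0 ≤ lam i := by
  have h := G.dotProduct_laplacian_nonneg (U.col i)
  rw [hU.mulVec_col, dotProduct_smul, hU.col_dotProduct_col] at h
  simpa using h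

/-- Otherwise every eigenvalue is positive, so every eigenvector is orthogonal to the kernel vector
`1`, forcing `1 = 0`. -/
theorem IsEigendecomposition.exists_eigenvalue_eq_zero {G : WeightedGraph N}
    {U : Matrix (Fin N) (Fin N) ℝ} {lam : Fin N → ℝ} (hN : 0 < N)
    (hU : IsEigendecomposition G.laplacian U lam) : lam ⟨0, hN⟩ = 0 := by
  by_contra hne
  have hpos : ∀ i, lam i ≠ 0 := fun i => by
    have h1 := hU.monotone (show (⟨0, hN⟩ : Fin N) ≤ i by simp [Fin.le_def])
    have h2 := lt_of_le_of_ne (hU.eigenvalue_nonneg ⟨0, hN⟩) (Ne.symm hne)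
    exact (h2.trans_le h1).ne'
  have horth : ∀ i, (1 : Fin N → ℝ) ⬝ᵥ U.col i = 0 := by
    intro i
    have h1 : (1 : Fin N → ℝ) ⬝ᵥ (G.laplacian *ᵥ U.col i) = 0 := by
      rw [dotProduct_mulVec, ← Matrix.mulVec_transpose, G.laplacian_transpose,
        G.laplacian_mulVec_one, zero_dotProduct]
    rw [hU.mulVec_col, dotProduct_smul, smul_eq_mul] at h1
    exact (mul_eq_zero.1 h1).resolve_left (hpos i)
  have h2 : Uᵀ *ᵥ (1 : Fin N → ℝ) = 0 := by
    ext i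
    have := horth i
    rw [dotProduct_comm] at this
    exact this
  have h3 : (1 : Fin N → ℝ) = 0 := by
    have h4 : U * Uᵀ = 1 := (Matrix.mem_orthogonalGroup_iff (Fin N) ℝ).1 hU.orthogonal
    rw [← Matrix.one_mulVec (1 : Fin N → ℝ), ← h4, ← Matrix.mulVec_mulVec, h2,
      Matrix.mulVec_zero]
  exact one_ne_zero (congrFun h3 ⟨0, hN⟩)

/-- A second zero eigenvalue would give two orthonormal constant vectors. -/
theorem IsEigendecomposition.eigenvalue_pos {G : WeightedGraph N}
    {U : Matrix (Fin N) (Fin N) ℝ} {lam : Fin N → ℝ} (hN : 0 < N)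
    (hG : G.toSimpleGraph.Connected) (hU : IsEigendecomposition G.laplacian U lam)
    {i : Fin N} (hi : i ≠ ⟨0, hN⟩) : 0 < lam i := by
  refine lt_of_le_of_ne (hU.eigenvalue_nonneg i) fun h0 => ?_
  have hci := hU.col_const_of_eq_zero hG h0.symm
  have hc0 := hU.col_const_of_eq_zero hG (hU.exists_eigenvalue_eq_zero hN)
  have h1 := hU.col_dotProduct_col i ⟨0, hN⟩
  have h2 := hU.col_dotProduct_col i i
  have h3 := hU.col_dotProduct_col ⟨0, hN⟩ ⟨0, hN⟩
  simp only [dotProduct, Matrix.col_apply, if_neg hi, if_true] at h1 h2 h3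
  set z : Fin N := ⟨0, hN⟩
  simp only [fun a => hci a z, fun a => hc0 a z, Finset.sum_const, smul_eq_zero,
    mul_eq_zero] at h1 h2 h3
  rcases h1 with h1 | h1 | h1
  · simp [h1] at h2
  · simp [h1] at h2
  · simp [h1] at h3

end GraphSampling

end Spectrum

/-! ### Zero-sum vectors. -/

section HarmonicExtension

open Matrix

/-- The vectors with zero sum. -/
noncomputable def zeroSum (κ : Type*) [Fintype κ] : Submodule ℝ (EuclideanSpace ℝ κ) :=
  (ℝ ∙ (WithLp.toLp 2 (1 : κ → ℝ)))ᗮ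

variable {κ : Type*} [Fintype κ]

theorem mem_zeroSum {v : EuclideanSpace ℝ κ} : v ∈ zeroSum κ ↔ ∑ i, v i = 0 := by
  rw [zeroSum, Submodule.mem_orthogonal_singleton_iff_inner_right]
  simp [PiLp.inner_apply]

theorem finrank_zeroSum [Nonempty κ] :
    Module.finrank ℝ (zeroSum κ) = Fintype.card κ - 1 := by
  have hne : (WithLp.toLp 2 (1 : κ → ℝ) : EuclideanSpace ℝ κ) ≠ 0 := by
    intro h
    have := congrArg (fun v : EuclideanSpace ℝ κ => v (Classical.arbitrary κ)) h
    simp at this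
  have h1 := (ℝ ∙ (WithLp.toLp 2 (1 : κ → ℝ))).finrank_add_finrank_orthogonal
  rw [finrank_span_singleton hne, finrank_euclideanSpace] at h1
  exact Nat.eq_sub_of_add_eq' h1

/-- Subtracting the mean of `v` leaves its products with zero-sum vectors unchanged; then Parseval
applies. -/
theorem sum_sq_dotProduct_basis_zeroSum [Nonempty κ] {p : ℕ}
    (g : OrthonormalBasis (Fin p) ℝ (zeroSum κ)) (v : κ → ℝ) :
    ∑ i, (v ⬝ᵥ (g i : EuclideanSpace ℝ κ).ofLp) ^ 2 =
      ∑ a, v a ^ 2 - (∑ a, v a) ^ 2 / Fintype.card κ := by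
  have hcard : (Fintype.card κ : ℝ) ≠ 0 := by exact_mod_cast Fintype.card_ne_zero
  set t : ℝ := (∑ a, v a) / Fintype.card κ with ht
  have hmem : (WithLp.toLp 2 (fun a => v a - t) : EuclideanSpace ℝ κ) ∈ zeroSum κ := by
    rw [mem_zeroSum]
    simp only [Finset.sum_sub_distrib, Finset.sum_const, Finset.card_univ, nsmul_eq_mul, ht]
    field_simp
    ring
  set v0 : zeroSum κ := ⟨_, hmem⟩ with hv0
  have h1 : ∀ i, v ⬝ᵥ (g i : EuclideanSpace ℝ κ).ofLp = inner ℝ (g i) v0 := by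
    intro i
    have h2 := mem_zeroSum.1 (g i).2
    have h3 : inner ℝ (g i) v0 = ∑ a, (v a - t) * (g i : EuclideanSpace ℝ κ) a := by
      simp [hv0, PiLp.inner_apply]
    rw [h3]
    simp only [sub_mul, Finset.sum_sub_distrib, ← Finset.mul_sum, h2, mul_zero, sub_zero]
    rfl
  have h4 := g.sum_sq_norm_inner_right v0
  simp only [h1]
  have h5 : ‖v0‖ ^ 2 = ∑ a, (v a - t) ^ 2 := by
    rw [Submodule.coe_norm, hv0, EuclideanSpace.norm_sq_eq]
    simp
  rw [h5] at h4
  simp only [Real.norm_eq_abs, sq_abs] at h4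
  rw [h4]
  have h6 : ∀ a, (v a - t) ^ 2 = v a ^ 2 - 2 * t * v a + t ^ 2 := fun a => by ring
  simp only [h6, Finset.sum_add_distrib, Finset.sum_sub_distrib, ← Finset.mul_sum,
    Finset.sum_const, Finset.card_univ, nsmul_eq_mul]
  rw [ht]
  field_simp
  ring

end HarmonicExtension

/-! ### Frobenius norm of the harmonic extension. -/

section HarmonicExtension

open Matrix

namespace GraphSampling

variable {n : ℕ} {G : WeightedGraph (n + 1)} {U : Matrix (Fin (n + 1)) (Fin (n + 1)) ℝ}
  {lam : Fin (n + 1) → ℝ}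

/-- The transposed eigenvector matrix without its first row. -/
def reducedBasis (U : Matrix (Fin (n + 1)) (Fin (n + 1)) ℝ) : Matrix (Fin n) (Fin (n + 1)) ℝ :=
  fun i a => U a i.succ

/-- The omitted eigenvector is constant with squared entries `1 / (n + 1)`, which accounts for the
correction term. -/
theorem reducedBasis_dotProduct (hG : G.toSimpleGraph.Connected)
    (hU : IsEigendecomposition G.laplacian U lam) (v z : Fin (n + 1) → ℝ) :
    (reducedBasis U *ᵥ v) ⬝ᵥ (reducedBasis U *ᵥ z) =
      v ⬝ᵥ z - (∑ a, v a) * (∑ a, z a) / (n + 1) := by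
  have h0 := hU.col_const_of_eq_zero hG (hU.exists_eigenvalue_eq_zero (Nat.succ_pos n))
  have hc : U 0 0 ^ 2 = 1 / (n + 1) := by
    have h1 := hU.col_dotProduct_col 0 0
    have h0' : ∀ a, U a 0 = U 0 0 := fun a => h0 a 0
    simp only [dotProduct, Matrix.col_apply, if_true, h0'] at h1
    have hn : (n + 1 : ℝ) ≠ 0 := by positivity
    simp at h1
    field_simp
    linarith
  have h2 : ∀ a b, ∑ i, reducedBasis U i a * reducedBasis U i b =
      (if a = b then 1 else 0) - 1 / (n + 1 : ℝ) := by
    intro a b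
    have h3 := hU.row_dotProduct_row a b
    rw [Fin.sum_univ_succ, show U a 0 = U 0 0 from h0 a 0, show U b 0 = U 0 0 from h0 b 0, ← sq,
      hc] at h3
    rw [← h3]
    simp [reducedBasis]
  calc (reducedBasis U *ᵥ v) ⬝ᵥ (reducedBasis U *ᵥ z)
      = ∑ i, ∑ a, ∑ b, (reducedBasis U i a * reducedBasis U i b) * (v a * z b) := by
        simp only [dotProduct, Matrix.mulVec, Finset.sum_mul_sum]
        exact Finset.sum_congr rfl fun i _ => Finset.sum_congr rfl fun a _ =>
          Finset.sum_congr rfl fun b _ => by ring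
    _ = ∑ a, ∑ b, (∑ i, reducedBasis U i a * reducedBasis U i b) * (v a * z b) := by
        rw [Finset.sum_comm]
        refine Finset.sum_congr rfl fun a _ => ?_
        rw [Finset.sum_comm]
        exact Finset.sum_congr rfl fun b _ => by rw [Finset.sum_mul]
    _ = _ := by
        simp only [h2, sub_mul, Finset.sum_sub_distrib, ite_mul, one_mul, zero_mul,
          Finset.sum_ite_eq, Finset.mem_univ, if_true, ← Finset.mul_sum]
        rw [← Finset.sum_mul, dotProduct]
        ring

theorem laplacian_eq_reducedBasis (hU : IsEigendecomposition G.laplacian U lam)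
    (v z : Fin (n + 1) → ℝ) :
    (reducedBasis U *ᵥ v) ⬝ᵥ (diagonal (fun i : Fin n => lam i.succ) *ᵥ (reducedBasis U *ᵥ z)) =
      v ⬝ᵥ (G.laplacian *ᵥ z) := by
  have h0 := hU.exists_eigenvalue_eq_zero (Nat.succ_pos n)
  have h1 : v ⬝ᵥ (G.laplacian *ᵥ z) = (Uᵀ *ᵥ v) ⬝ᵥ (diagonal lam *ᵥ (Uᵀ *ᵥ z)) := by
    conv_lhs => rw [hU.decomp]
    rw [← Matrix.mulVec_mulVec, ← Matrix.mulVec_mulVec, Matrix.dotProduct_mulVec,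
      ← Matrix.mulVec_transpose]
  rw [h1]
  simp only [dotProduct, Matrix.mulVec_diagonal]
  rw [Fin.sum_univ_succ]
  have h0' : lam 0 = 0 := h0
  rw [h0', zero_mul, mul_zero, zero_add]
  rfl

/-- Each product `q_a (L q)_a` vanishes, so the energy does; `q` is then constant and zero on `S`.
-/
theorem WeightedGraph.eq_zero_of_harmonic {N : ℕ} {G : WeightedGraph N}
    (hG : G.toSimpleGraph.Connected) {S : Finset (Fin N)} (hS : S.Nonempty) {q : Fin N → ℝ}
    (hq : ∀ a ∈ S, q a = 0) (hLq : ∀ a ∉ S, (G.laplacian *ᵥ q) a = 0) : q = 0 := by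
  obtain ⟨a, ha⟩ := hS
  refine G.eq_zero_of_dotProduct_laplacian_eq_zero hG ?_ (hq a ha)
  refine Finset.sum_eq_zero fun b _ => ?_
  by_cases hb : b ∈ S
  · rw [hq b hb, zero_mul]
  · rw [hLq b hb, mul_zero]

/-- Index bookkeeping: in the list `λ_2, …, λ_N` of length `n`, `λ_i` sits at position `i - 2` and
`λ_{N+2-i}` at the mirror position. -/
theorem boundB_eq (hn : 0 < n) (lam : Fin (n + 1) → ℝ) {m : ℕ} (hm : 0 < m) (hmN : m ≤ n + 1) :
    boundB lam m = omegaK (lam (Fin.rev ⟨0, hn⟩ : Fin n).succ / lam (⟨0, hn⟩ : Fin n).succ) *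
        ((n + 1 : ℝ) / m) +
      ∑ i : Fin (m - 1), omegaK (max 1
        (lam (Fin.rev (Fin.castLE (by omega : m - 1 ≤ n) i)).succ /
          lam (Fin.castLE (by omega : m - 1 ≤ n) i).succ)) := by
  have e1 : eigenvalueAt lam (n + 1) = lam (Fin.rev ⟨0, hn⟩ : Fin n).succ := by
    simp only [eigenvalueAt]
    rw [dif_pos (by omega)]
    congr 1
    ext
    simp
    omega
  have e2 : eigenvalueAt lam 2 = lam (⟨0, hn⟩ : Fin n).succ := by
    simp only [eigenvalueAt]
    rw [dif_pos (by omega)]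
    rfl
  have hI : Finset.Icc 2 m = Finset.Ico 2 (m + 1) := rfl
  rw [boundB, spreadR, e1, e2, hI, Finset.sum_Ico_eq_sum_range, show m + 1 - 2 = m - 1 by omega,
    Finset.sum_range]
  push_cast
  congr 1
  refine Finset.sum_congr rfl fun i _ => ?_
  have hi := i.isLt
  congr 3
  · simp only [eigenvalueAt]
    rw [dif_pos (by omega)]
    congr 1
    ext
    simp
    omega
  · simp only [eigenvalueAt]
    rw [dif_pos (by omega)]
    congr 1
    ext
    simp
    omega

set_option maxHeartbeats 400000 in
/-- The Frobenius norm of the harmonic extension operator from `S` is controlled by `boundB`. -/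
theorem sum_sq_harmonicExtension_le (hn : 0 < n) (hG : G.toSimpleGraph.Connected)
    (hU : IsEigendecomposition G.laplacian U lam) {S : Finset (Fin (n + 1))} (hS : S.Nonempty)
    (H : Matrix (Fin (n + 1)) S ℝ) (hHS : ∀ i l : S, H i l = if i = l then 1 else 0)
    (hLH : ∀ a ∉ S, ∀ l, (G.laplacian * H) a l = 0) :
    ∑ a, ∑ l, H a l ^ 2 ≤ boundB lam S.card := by
  classical
  have : Nonempty S := hS.to_subtype
  set m := S.card with hm
  have hm0 : 0 < m := hS.card_pos
  have hmR : (0 : ℝ) < m := by exact_mod_cast hm0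
  have hmN : m ≤ n + 1 := by simpa using S.card_le_univ
  have hcard : Fintype.card S = m := by simp [hm]
  set Y := reducedBasis U with hY
  set w : Fin n → ℝ := fun i => lam i.succ with hw
  have hwpos : ∀ i, 0 < w i := fun i => hU.eigenvalue_pos (Nat.succ_pos n) hG
    (Fin.succ_ne_zero i)
  have hwm : Monotone w := fun i l hil => hU.monotone (Fin.succ_le_succ_iff.2 hil)
  set E : Matrix (Fin (n + 1)) S ℝ := fun a l => if a = l then 1 else 0 with hE
  have hES : ∀ (f : S → ℝ) (l : S), (E *ᵥ f) l = f l := by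
    intro f l
    simp [hE, Matrix.mulVec, dotProduct]
  have hEc : ∀ (f : S → ℝ) (a), a ∉ S → (E *ᵥ f) a = 0 := by
    intro f a ha
    refine Finset.sum_eq_zero fun l _ => ?_
    have : a ≠ l := fun h => ha (h ▸ l.2)
    simp [hE, this]
  have hHSv : ∀ (f : S → ℝ) (l : S), (H *ᵥ f) l = f l := by
    intro f l
    simp [Matrix.mulVec, dotProduct, hHS]
  have hLHc : ∀ (f : S → ℝ) (a), a ∉ S → (G.laplacian *ᵥ (H *ᵥ f)) a = 0 := by
    intro f a ha
    rw [Matrix.mulVec_mulVec]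
    exact Finset.sum_eq_zero fun l _ => by simp [hLH a ha]
  have hsumS : ∀ f : Fin (n + 1) → ℝ, (∀ a, a ∉ S → f a = 0) → ∑ a, f a = ∑ l : S, f l := by
    intro f hf
    rw [Finset.sum_coe_sort S f]
    exact (Finset.sum_subset (Finset.subset_univ S) fun a _ ha => hf a ha).symm
  have hEdot : ∀ (f : S → ℝ) (v : Fin (n + 1) → ℝ), (E *ᵥ f) ⬝ᵥ v = ∑ l : S, f l * v l := by
    intro f v
    rw [dotProduct, hsumS _ fun a ha => by rw [hEc f a ha, zero_mul]]
    exact Finset.sum_congr rfl fun l _ => by rw [hES]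
  have hEsum : ∀ f : S → ℝ, ∑ a, (E *ᵥ f) a = ∑ l, f l := by
    intro f
    rw [hsumS _ (hEc f)]
    exact Finset.sum_congr rfl fun l _ => hES f l
  -- The constant `1` is its own harmonic extension, by uniqueness.
  have hHone : ∀ a, ∑ l, H a l = 1 := by
    have h := WeightedGraph.eq_zero_of_harmonic hG hS (q := H *ᵥ 1 - 1)
      (fun a ha => by simp [hHSv 1 ⟨a, ha⟩])
      (fun a ha => by
        rw [Matrix.mulVec_sub, G.laplacian_mulVec_one, sub_zero]
        exact hLHc 1 a ha)
    intro a
    have h1 : (H *ᵥ 1) a = 1 := sub_eq_zero.1 (congrFun h a)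
    simpa [Matrix.mulVec, dotProduct] using h1
  -- the two linear maps to reduced coordinates
  let φ : zeroSum S →ₗ[ℝ] (S → ℝ) :=
    (WithLp.linearEquiv 2 ℝ (S → ℝ)).toLinearMap ∘ₗ (zeroSum S).subtype
  have hφsum : ∀ g, ∑ l, φ g l = 0 := fun g => mem_zeroSum.1 g.2
  have hφdot : ∀ g g', φ g ⬝ᵥ φ g' = inner ℝ g g' := by
    intro g g'
    simp [φ, PiLp.inner_apply, dotProduct, mul_comm]
  let ι : zeroSum S →ₗ[ℝ] (Fin n → ℝ) := (Y.mulVecLin ∘ₗ E.mulVecLin) ∘ₗ φ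
  let T : zeroSum S →ₗ[ℝ] (Fin n → ℝ) := (Y.mulVecLin ∘ₗ (H - E).mulVecLin) ∘ₗ φ
  have hιdef : ∀ g, ι g = Y *ᵥ (E *ᵥ φ g) := fun g => rfl
  have hTdef : ∀ g, T g = Y *ᵥ (H *ᵥ φ g - E *ᵥ φ g) := fun g => by
    rw [← Matrix.sub_mulVec]; rfl
  have hιT_add : ∀ g, ι g + T g = Y *ᵥ (H *ᵥ φ g) := fun g => by
    rw [hιdef, hTdef, ← Matrix.mulVec_add, add_sub_cancel]
  have hdiff : ∀ (f : S → ℝ) (a), a ∈ S → (H *ᵥ f - E *ᵥ f) a = 0 := by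
    intro f a ha
    have h1 := hHSv f ⟨a, ha⟩
    have h2 := hES f ⟨a, ha⟩
    simp only at h1 h2
    rw [Pi.sub_apply, h1, h2, sub_self]
  have hι : ∀ g g', ι g ⬝ᵥ ι g' = inner ℝ g g' := by
    intro g g'
    rw [hιdef, hιdef, reducedBasis_dotProduct hG hU, hEsum, hφsum, hEdot, ← hφdot]
    simp [hES, dotProduct]
  -- `E f` lives on `S` and `(H - E) f` off `S`; the zero sum of `φ g` removes the correction term.
  -- The weighted relation `hT` likewise uses that `L H` vanishes off `S`.
  have hιT : ∀ g g', ι g ⬝ᵥ T g' = 0 := by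
    intro g g'
    rw [hιdef, hTdef, reducedBasis_dotProduct hG hU, hEsum, hφsum, hEdot]
    simp [hdiff]
  have hT : ∀ g g', T g ⬝ᵥ (diagonal w *ᵥ (ι g' + T g')) = 0 := by
    intro g g'
    rw [hιT_add, hTdef, laplacian_eq_reducedBasis hU]
    refine Finset.sum_eq_zero fun a _ => ?_
    by_cases ha : a ∈ S
    · rw [hdiff _ a ha, zero_mul]
    · rw [hLHc _ a ha, mul_zero]
  have hp : Module.finrank ℝ (zeroSum S) = m - 1 := by rw [finrank_zeroSum, hcard]
  obtain ⟨g, s, hs0, hTT, hsum, hmax⟩ :=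
    exists_basis_sum_one_add_sq_le hp (by omega : m - 1 ≤ n) hwpos hwm ι T hι hιT hT
  set r := omegaK (w (Fin.rev ⟨0, hn⟩) / w ⟨0, hn⟩) with hr
  have hr1 : 1 ≤ r := by
    exact one_le_omegaK (div_pos (hwpos _) (hwpos _))
  -- the component of the extension along the constants
  set t : Fin (m - 1) → ℝ := fun i => ∑ a, (H *ᵥ φ (g i)) a with ht
  have htbound : (∑ i, t i ^ 2) * m ≤ (r - 1) * (n + 1) ^ 2 := by
    set W := ∑ i, t i ^ 2 with hW
    have hW0 : 0 ≤ W := Finset.sum_nonneg fun i _ => sq_nonneg _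
    -- These coefficients make the total sum of the extension of `f` equal to `W = ∑ t_i²`. Testing
    -- `T f` against the indicator of `S` and using `‖T f‖² ≤ (r - 1) W` then bounds `W`.
    set f := ∑ i, t i • g i with hf
    have hft : ∑ a, (H *ᵥ φ f) a = W := by
      have : H *ᵥ φ f = ∑ i, t i • (H *ᵥ φ (g i)) := by
        simp only [hf, map_sum, map_smul, ← Matrix.mulVecLin_apply]
      rw [this]
      simp only [Finset.sum_apply, Pi.smul_apply, smul_eq_mul]
      rw [Finset.sum_comm]
      simp only [← Finset.mul_sum]
      exact Finset.sum_congr rfl fun i _ => by rw [sq]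
    have hTf : T f ⬝ᵥ T f ≤ (r - 1) * W := by
      have h1 : T f = ∑ i, t i • T (g i) := by simp only [hf, map_sum, map_smul]
      have h2 : T f ⬝ᵥ T f = ∑ i, t i ^ 2 * s i ^ 2 := by
        rw [h1, sum_dotProduct]
        refine Finset.sum_congr rfl fun i _ => ?_
        rw [dotProduct_sum]
        simp only [smul_dotProduct, dotProduct_smul, hTT, smul_eq_mul, mul_ite, mul_zero,
          Finset.sum_ite_eq, Finset.mem_univ, if_true]
        ring
      rw [h2, hW, Finset.mul_sum]
      refine Finset.sum_le_sum fun i _ => ?_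
      have := hmax i hn
      nlinarith [sq_nonneg (t i)]
    have hone : (Y *ᵥ (E *ᵥ 1)) ⬝ᵥ T f = - (m * W / (n + 1)) := by
      rw [hTdef, reducedBasis_dotProduct hG hU, hEdot, hEsum]
      simp only [Pi.sub_apply, Finset.sum_sub_distrib, hft, hEsum, hφsum, hHSv, hES]
      simp [← hm]
    have honeone : (Y *ᵥ (E *ᵥ 1)) ⬝ᵥ (Y *ᵥ (E *ᵥ 1)) ≤ m := by
      rw [reducedBasis_dotProduct hG hU, hEdot]
      simp only [hES, hEsum]
      simp only [Pi.one_apply, mul_one, Finset.sum_const, Finset.card_univ, hcard, nsmul_eq_mul]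
      have : 0 ≤ (m : ℝ) * m / (n + 1) := by positivity
      linarith
    have hcs : ((Y *ᵥ (E *ᵥ 1)) ⬝ᵥ T f) ^ 2 ≤
        ((Y *ᵥ (E *ᵥ 1)) ⬝ᵥ (Y *ᵥ (E *ᵥ 1))) * (T f ⬝ᵥ T f) := by
      have := Finset.sum_mul_sq_le_sq_mul_sq Finset.univ (Y *ᵥ (E *ᵥ 1)) (T f)
      simpa [dotProduct, ← sq] using this
    have hTf0 : 0 ≤ T f ⬝ᵥ T f := Finset.sum_nonneg fun i _ => mul_self_nonneg _
    have h1 : (m * W / (n + 1)) ^ 2 ≤ m * ((r - 1) * W) := by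
      calc _ = ((Y *ᵥ (E *ᵥ 1)) ⬝ᵥ T f) ^ 2 := by rw [hone, neg_sq]
        _ ≤ _ := hcs
        _ ≤ m * (T f ⬝ᵥ T f) := mul_le_mul_of_nonneg_right honeone hTf0
        _ ≤ _ := mul_le_mul_of_nonneg_left hTf hmR.le
    have hnR : (0 : ℝ) < n + 1 := by positivity
    rcases hW0.eq_or_lt with hW' | hW'
    · rw [← hW', zero_mul]
      exact mul_nonneg (sub_nonneg.2 hr1) (sq_nonneg _)
    · rw [div_pow, div_le_iff₀ (pow_pos hnR 2)] at h1
      have h2 : (m * W) * (W * m) ≤ (m * W) * ((r - 1) * (n + 1) ^ 2) := by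
        calc _ = (m * W) ^ 2 := by ring
          _ ≤ _ := h1
          _ = _ := by ring
      exact le_of_mul_le_mul_left h2 (mul_pos hmR hW')
  have hcol : ∀ i, ∑ a, (H *ᵥ φ (g i)) a ^ 2 = 1 + s i ^ 2 + t i ^ 2 / (n + 1) := by
    intro i
    have h1 := reducedBasis_dotProduct hG hU (H *ᵥ φ (g i)) (H *ᵥ φ (g i))
    rw [← hY, ← hιT_add, add_dotProduct, dotProduct_add, dotProduct_add, hι, hιT,
      dotProduct_comm (T _), hιT, hTT, if_pos rfl, g.inner_eq_ite, if_pos rfl] at h1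
    have h2 : ∑ a, (H *ᵥ φ (g i)) a ^ 2 = (H *ᵥ φ (g i)) ⬝ᵥ (H *ᵥ φ (g i)) := by
      simp [dotProduct, sq]
    rw [h2, ht]
    simp only
    rw [sq (∑ a, _)]
    linarith
  -- The zero-sum basis misses only the constant direction of `ℝ^S`, where a row of sum `1`
  -- contributes `1 / m`.
  have hrow : ∀ a, ∑ l, H a l ^ 2 = ∑ i, (H *ᵥ φ (g i)) a ^ 2 + 1 / m := by
    intro a
    have h1 := sum_sq_dotProduct_basis_zeroSum g (fun l => H a l)
    rw [hHone, hcard] at h1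
    have h2 : ∑ i, (H *ᵥ φ (g i)) a ^ 2 = ∑ l, H a l ^ 2 - 1 ^ 2 / m := h1
    rw [h2]
    ring
  have htotal : ∑ a, ∑ l, H a l ^ 2 =
      ∑ i, (1 + s i ^ 2) + (∑ i, t i ^ 2) / (n + 1) + (n + 1) / m := by
    simp only [hrow, Finset.sum_add_distrib, Finset.sum_const, Finset.card_univ,
      Fintype.card_fin, nsmul_eq_mul]
    rw [Finset.sum_comm]
    simp only [hcol, Finset.sum_add_distrib, Finset.sum_div]
    simp
    ring
  have hnR : (0 : ℝ) < n + 1 := by positivity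
  have hpart : (∑ i, t i ^ 2) / (n + 1) + (n + 1) / m ≤ r * ((n + 1 : ℝ) / m) := by
    have h1 : (∑ i, t i ^ 2) / (n + 1) ≤ (r - 1) * ((n + 1) / m) := by
      rw [div_le_iff₀ hnR, mul_div_assoc', div_mul_eq_mul_div, le_div_iff₀ hmR]
      linarith
    linarith
  rw [htotal, boundB_eq hn lam hm0 hmN]
  linarith

end GraphSampling

end HarmonicExtension

/-! ### GLR reconstruction as a linear map and its Frobenius norm. -/

section Reconstruction

open Matrix

namespace GraphSampling

variable {N : ℕ}

/-- The coordinate projection onto the vertices in `S`. -/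
def vertexProjection (S : Finset (Fin N)) : Matrix (Fin N) (Fin N) ℝ :=
  diagonal fun a => if a ∈ S then 1 else 0

/-- The matrix of the normal equations of GLR reconstruction. -/
def glrSystem (L : Matrix (Fin N) (Fin N) ℝ) (μ : ℝ) (S : Finset (Fin N)) :
    Matrix (Fin N) (Fin N) ℝ :=
  vertexProjection S + μ • L

/-- The matrix of GLR reconstruction, acting on the full signal. -/
noncomputable def glrMatrix (L : Matrix (Fin N) (Fin N) ℝ) (μ : ℝ) (S : Finset (Fin N)) :
    Matrix (Fin N) (Fin N) ℝ :=
  (glrSystem L μ S)⁻¹ * vertexProjection S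

theorem vertexProjection_mulVec (S : Finset (Fin N)) (v : Fin N → ℝ) (a : Fin N) :
    (vertexProjection S *ᵥ v) a = if a ∈ S then v a else 0 := by
  rw [vertexProjection, Matrix.mulVec_diagonal]
  split_ifs <;> simp

theorem dotProduct_vertexProjection (S : Finset (Fin N)) (v z : Fin N → ℝ) :
    v ⬝ᵥ (vertexProjection S *ᵥ z) = ∑ a : S, v a * z a := by
  rw [Finset.sum_coe_sort S (fun a => v a * z a)]
  simp only [dotProduct, vertexProjection_mulVec, mul_ite, mul_zero]
  rw [Finset.sum_ite_mem, Finset.univ_inter]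

theorem dotProduct_glrSystem (L : Matrix (Fin N) (Fin N) ℝ) (μ : ℝ) (S : Finset (Fin N))
    (v z : Fin N → ℝ) :
    v ⬝ᵥ (glrSystem L μ S *ᵥ z) = ∑ a : S, v a * z a + μ * (v ⬝ᵥ (L *ᵥ z)) := by
  rw [glrSystem, Matrix.add_mulVec, dotProduct_add, dotProduct_vertexProjection,
    Matrix.smul_mulVec, dotProduct_smul, smul_eq_mul]

variable {G : WeightedGraph N} {μ : ℝ} {S : Finset (Fin N)}

theorem glrSystem_transpose : (glrSystem G.laplacian μ S)ᵀ = glrSystem G.laplacian μ S := by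
  rw [glrSystem, Matrix.transpose_add, Matrix.transpose_smul, G.laplacian_transpose,
    vertexProjection, Matrix.diagonal_transpose]

theorem eq_zero_of_dotProduct_glrSystem_nonpos (hG : G.toSimpleGraph.Connected) (hμ : 0 < μ)
    (hS : S.Nonempty) {v : Fin N → ℝ} (hv : v ⬝ᵥ (glrSystem G.laplacian μ S *ᵥ v) ≤ 0) :
    v = 0 := by
  rw [dotProduct_glrSystem] at hv
  have h1 : 0 ≤ ∑ a : S, v a * v a := Finset.sum_nonneg fun a _ => mul_self_nonneg _
  have h2 := mul_nonneg hμ.le (G.dotProduct_laplacian_nonneg v)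
  have h3 : μ * (v ⬝ᵥ (G.laplacian *ᵥ v)) = 0 := by linarith
  have h4 : ∑ a : S, v a * v a = 0 := by linarith
  rw [Finset.sum_eq_zero_iff_of_nonneg fun a _ => mul_self_nonneg _] at h4
  obtain ⟨a, ha⟩ := hS
  exact G.eq_zero_of_dotProduct_laplacian_eq_zero hG ((mul_eq_zero.1 h3).resolve_left hμ.ne')
    (mul_self_eq_zero.1 (h4 ⟨a, ha⟩ (Finset.mem_univ _)))

theorem isUnit_det_glrSystem (hG : G.toSimpleGraph.Connected) (hμ : 0 < μ) (hS : S.Nonempty) :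
    IsUnit (glrSystem G.laplacian μ S).det := by
  rw [← Matrix.isUnit_iff_isUnit_det, ← Matrix.mulVec_injective_iff_isUnit]
  intro v z hvz
  have h : glrSystem G.laplacian μ S *ᵥ (v - z) = 0 := by
    rw [Matrix.mulVec_sub, sub_eq_zero]
    exact hvz
  exact sub_eq_zero.1 (eq_zero_of_dotProduct_glrSystem_nonpos hG hμ hS
    (by rw [h, dotProduct_zero]))

theorem glrSystem_mul_glrMatrix (hG : G.toSimpleGraph.Connected) (hμ : 0 < μ)
    (hS : S.Nonempty) :
    glrSystem G.laplacian μ S * glrMatrix G.laplacian μ S = vertexProjection S := by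
  rw [glrMatrix, ← Matrix.mul_assoc, Matrix.mul_nonsing_inv _ (isUnit_det_glrSystem hG hμ hS),
    Matrix.one_mul]

/-- Completing the square around the solution of the normal equations. -/
theorem glrObjective_eq (hG : G.toSimpleGraph.Connected) (hμ : 0 < μ) (hS : S.Nonempty)
    (y z : Fin N → ℝ) :
    glrObjective G.laplacian μ S (fun a : S => y a) z =
      glrObjective G.laplacian μ S (fun a : S => y a) (glrMatrix G.laplacian μ S *ᵥ y) +
        (z - glrMatrix G.laplacian μ S *ᵥ y) ⬝ᵥ
          (glrSystem G.laplacian μ S *ᵥ (z - glrMatrix G.laplacian μ S *ᵥ y)) := by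
  have hform : ∀ z, glrObjective G.laplacian μ S (fun a : S => y a) z =
      z ⬝ᵥ (glrSystem G.laplacian μ S *ᵥ z) - 2 * (z ⬝ᵥ (vertexProjection S *ᵥ y)) +
        ∑ a : S, y a ^ 2 := by
    intro z
    have h1 : ∑ a : S, (z a - y a) ^ 2 =
        ∑ a : S, z a * z a - 2 * ∑ a : S, z a * y a + ∑ a : S, y a ^ 2 := by
      rw [Finset.mul_sum, ← Finset.sum_sub_distrib, ← Finset.sum_add_distrib]
      exact Finset.sum_congr rfl fun a _ => by ring
    rw [glrObjective, sqNorm, h1, dotProduct_glrSystem, dotProduct_vertexProjection]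
    ring
  set z₀ := glrMatrix G.laplacian μ S *ᵥ y with hz₀
  have hsys : glrSystem G.laplacian μ S *ᵥ z₀ = vertexProjection S *ᵥ y := by
    rw [hz₀, Matrix.mulVec_mulVec, glrSystem_mul_glrMatrix hG hμ hS]
  have hsymm : z₀ ⬝ᵥ (glrSystem G.laplacian μ S *ᵥ z) =
      z ⬝ᵥ (vertexProjection S *ᵥ y) := by
    rw [dotProduct_mulVec, ← Matrix.mulVec_transpose, glrSystem_transpose, hsys,
      dotProduct_comm]
  rw [hform, hform, Matrix.mulVec_sub, dotProduct_sub, sub_dotProduct, sub_dotProduct, hsymm,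
    hsys]
  ring

/-- The excess over the value at `z₀` is a positive definite form, so the minimiser is unique and
`Classical.epsilon` can only select `z₀`. -/
theorem glrReconstruction_eq (hG : G.toSimpleGraph.Connected) (hμ : 0 < μ) (hS : S.Nonempty)
    (y : Fin N → ℝ) :
    glrReconstruction G.laplacian μ S (fun a : S => y a) = glrMatrix G.laplacian μ S *ᵥ y := by
  set z₀ := glrMatrix G.laplacian μ S *ᵥ y with hz₀
  have hmin : IsMinOn (glrObjective G.laplacian μ S fun a : S => y a) Set.univ z₀ := by
    intro z _
    rw [Set.mem_ofPred_eq, glrObjective_eq hG hμ hS y z]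
    refine le_add_of_nonneg_right ?_
    rw [dotProduct_glrSystem]
    exact add_nonneg (Finset.sum_nonneg fun a _ => mul_self_nonneg _)
      (mul_nonneg hμ.le (G.dotProduct_laplacian_nonneg _))
  have hspec := Classical.epsilon_spec
    (p := fun z => IsMinOn (glrObjective G.laplacian μ S fun a : S => y a) Set.univ z)
    ⟨z₀, hmin⟩
  change IsMinOn _ Set.univ (glrReconstruction G.laplacian μ S fun a : S => y a) at hspec
  set z := glrReconstruction G.laplacian μ S fun a : S => y a
  have h1 : glrObjective G.laplacian μ S (fun a : S => y a) z ≤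
      glrObjective G.laplacian μ S (fun a : S => y a) z₀ := hspec (Set.mem_univ z₀)
  rw [glrObjective_eq hG hμ hS y z] at h1
  exact sub_eq_zero.1 (eq_zero_of_dotProduct_glrSystem_nonpos hG hμ hS (by linarith))

/-- Off `S` the normal equations say that the reconstruction is harmonic, so it is the harmonic
extension `H` of its own values on `S`, which `J` computes. The bound is uniform in `μ` because `J`
is a contraction. -/
theorem sum_sq_glrMatrix_le {n : ℕ} {G : WeightedGraph (n + 1)}
    {U : Matrix (Fin (n + 1)) (Fin (n + 1)) ℝ} {lam : Fin (n + 1) → ℝ}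
    {S : Finset (Fin (n + 1))} (hn : 0 < n)
    (hG : G.toSimpleGraph.Connected) (hU : IsEigendecomposition G.laplacian U lam)
    (hμ : 0 < μ) (hS : S.Nonempty) :
    ∑ a, ∑ b, glrMatrix G.laplacian μ S a b ^ 2 ≤ boundB lam S.card := by
  classical
  set R := glrMatrix G.laplacian μ S with hR
  set M := glrSystem G.laplacian μ S with hM
  set Rs : Matrix (Fin (n + 1)) S ℝ := fun a l => R a l with hRs
  set J : Matrix S S ℝ := fun i l => R i l with hJ
  have hMR : M * R = vertexProjection S := glrSystem_mul_glrMatrix hG hμ hS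
  have hRoff : ∀ a b, b ∉ S → R a b = 0 := by
    intro a b hb
    rw [hR, glrMatrix, vertexProjection, Matrix.mul_diagonal, if_neg hb, mul_zero]
  have hRS : ∀ a b, b ∈ S → R a b = M⁻¹ a b := by
    intro a b hb
    rw [hR, glrMatrix, vertexProjection, Matrix.mul_diagonal, if_pos hb, mul_one]
  have hJt : ∀ i l, J i l = J l i := by
    intro i l
    have h1 : (M⁻¹)ᵀ = M⁻¹ := by
      rw [Matrix.transpose_nonsing_inv, hM, glrSystem_transpose]
    simp only [hJ]
    rw [hRS _ _ l.2, hRS _ _ i.2]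
    exact congrFun (congrFun h1 l.val) i.val
  let ext : (S → ℝ) → (Fin (n + 1) → ℝ) := fun v a => if h : a ∈ S then v ⟨a, h⟩ else 0
  have hext : ∀ v (l : S), ext v l = v l := fun v l => by simp [ext]
  have hRsv : ∀ v, Rs *ᵥ v = R *ᵥ ext v := by
    intro v
    ext a
    simp only [Matrix.mulVec, dotProduct]
    rw [← Finset.sum_subset (Finset.subset_univ S)
      (fun b _ hb => by rw [hRoff a b hb, zero_mul]), ← Finset.sum_coe_sort S]
    exact Finset.sum_congr rfl fun l _ => by rw [hext]
  have hJv : ∀ v (l : S), (J *ᵥ v) l = (Rs *ᵥ v) l := fun v l => rfl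
  have hMRs : ∀ v, M *ᵥ (Rs *ᵥ v) = vertexProjection S *ᵥ ext v := fun v => by
    rw [hRsv, Matrix.mulVec_mulVec, hMR]
  have hLoff : ∀ v a, a ∉ S → (G.laplacian *ᵥ (Rs *ᵥ v)) a = 0 := by
    intro v a ha
    have h1 := congrFun (hMRs v) a
    rw [hM, glrSystem, Matrix.add_mulVec, Pi.add_apply, vertexProjection_mulVec,
      vertexProjection_mulVec, if_neg ha, if_neg ha, zero_add, Matrix.smul_mulVec,
      Pi.smul_apply, smul_eq_mul] at h1
    exact (mul_eq_zero.1 h1).resolve_left hμ.ne'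
  have hJunit : IsUnit J.det := by
    rw [← Matrix.isUnit_iff_isUnit_det, ← Matrix.mulVec_injective_iff_isUnit]
    intro v z hvz
    have h0 : J *ᵥ (v - z) = 0 := by
      rw [Matrix.mulVec_sub, sub_eq_zero]
      exact hvz
    have h1 : Rs *ᵥ (v - z) = 0 := WeightedGraph.eq_zero_of_harmonic hG hS
      (fun a ha => by
        have := congrFun h0 ⟨a, ha⟩
        rwa [hJv] at this) (hLoff _)
    have h2 := hMRs (v - z)
    rw [h1, Matrix.mulVec_zero] at h2
    refine sub_eq_zero.1 (funext fun l => ?_)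
    have h3 := congrFun h2 l.val
    rw [vertexProjection_mulVec, if_pos l.2, hext] at h3
    exact h3.symm
  -- Pairing the normal equations with their solution gives `‖J v‖² ≤ ⟨J v, v⟩`, since the energy is
  -- nonnegative.
  have hcontr : ∀ v, ∑ l, (J *ᵥ v) l ^ 2 ≤ ∑ l, v l ^ 2 := by
    intro v
    have h1 : (Rs *ᵥ v) ⬝ᵥ (M *ᵥ (Rs *ᵥ v)) = ∑ l, (J *ᵥ v) l * v l := by
      rw [hMRs, dotProduct_vertexProjection]
      exact Finset.sum_congr rfl fun l _ => by rw [hext, hJv]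
    rw [hM, dotProduct_glrSystem] at h1
    have h2 := mul_nonneg hμ.le (G.dotProduct_laplacian_nonneg (Rs *ᵥ v))
    have h3 : ∑ l : S, (Rs *ᵥ v) l * (Rs *ᵥ v) l = ∑ l, (J *ᵥ v) l ^ 2 :=
      Finset.sum_congr rfl fun l _ => by rw [hJv, sq]
    rw [h3] at h1
    have h4 : 0 ≤ ∑ l, (v l - (J *ᵥ v) l) ^ 2 := Finset.sum_nonneg fun l _ => sq_nonneg _
    have h5 : ∑ l, (v l - (J *ᵥ v) l) ^ 2 =
        ∑ l, v l ^ 2 - 2 * ∑ l, (J *ᵥ v) l * v l + ∑ l, (J *ᵥ v) l ^ 2 := by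
      rw [Finset.mul_sum, ← Finset.sum_sub_distrib, ← Finset.sum_add_distrib]
      exact Finset.sum_congr rfl fun l _ => by ring
    linarith
  set H := Rs * J⁻¹ with hH
  have hHJ : H * J = Rs := by
    rw [hH, Matrix.mul_assoc, Matrix.nonsing_inv_mul _ hJunit, Matrix.mul_one]
  have hbound := sum_sq_harmonicExtension_le hn hG hU hS H
    (fun i l => by
      have h1 : H i l = (J * J⁻¹) i l := rfl
      rw [h1, Matrix.mul_nonsing_inv _ hJunit, Matrix.one_apply])
    (fun a ha l => by
      have h1 : (G.laplacian * H) a l = (G.laplacian *ᵥ (Rs *ᵥ fun k => J⁻¹ k l)) a := rfl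
      rw [h1, hLoff _ a ha])
  refine le_trans ?_ hbound
  -- Row by row: by symmetry of `J`, a row of `R` on `S` is `J` applied to the corresponding row of
  -- `H`.
  refine Finset.sum_le_sum fun a _ => ?_
  have h1 : ∑ b, R a b ^ 2 = ∑ l : S, (J *ᵥ fun k => H a k) l ^ 2 := by
    rw [← Finset.sum_subset (Finset.subset_univ S)
      (fun b _ hb => by rw [hRoff a b hb]; norm_num), ← Finset.sum_coe_sort S]
    refine Finset.sum_congr rfl fun l _ => ?_
    have h2 : R a l = (H * J) a l := by rw [hHJ]
    rw [h2, Matrix.mul_apply]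
    simp only [Matrix.mulVec, dotProduct]
    congr 1
    exact Finset.sum_congr rfl fun k _ => by rw [hJt l k, mul_comm]
  rw [h1]
  exact hcontr _

/-- The system matrix is `1 + μ L`, which `U` diagonalises; the left side is the trace of `R Rᵀ`. -/
theorem sum_sq_glrMatrix_univ {U : Matrix (Fin N) (Fin N) ℝ} {lam : Fin N → ℝ}
    (hU : IsEigendecomposition G.laplacian U lam) (hμ : 0 < μ) :
    ∑ a, ∑ b, glrMatrix G.laplacian μ Finset.univ a b ^ 2 = ∑ i, (1 / (1 + μ * lam i)) ^ 2 := by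
  have h1 : Uᵀ * U = 1 := (Matrix.mem_orthogonalGroup_iff' (Fin N) ℝ).1 hU.orthogonal
  have h2 : U * Uᵀ = 1 := (Matrix.mem_orthogonalGroup_iff (Fin N) ℝ).1 hU.orthogonal
  have hone : vertexProjection (Finset.univ : Finset (Fin N)) = 1 := by
    simp [vertexProjection]
  set D : Matrix (Fin N) (Fin N) ℝ := diagonal fun i => 1 / (1 + μ * lam i) with hD
  have hpos : ∀ i, 1 + μ * lam i ≠ 0 := fun i =>
    (add_pos_of_pos_of_nonneg one_pos (mul_nonneg hμ.le (hU.eigenvalue_nonneg i))).ne'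
  have hsys : glrSystem G.laplacian μ Finset.univ =
      U * diagonal (fun i => 1 + μ * lam i) * Uᵀ := by
    have h3 : (diagonal fun i => 1 + μ * lam i : Matrix (Fin N) (Fin N) ℝ) =
        1 + μ • diagonal lam := by
      ext a b
      by_cases hab : a = b
      · subst hab; simp
      · simp [hab]
    rw [glrSystem, hone, h3, Matrix.mul_add, Matrix.add_mul, Matrix.mul_one, h2]
    conv_lhs => rw [hU.decomp]
    simp
  have hinv : glrMatrix G.laplacian μ Finset.univ = U * D * Uᵀ := by
    rw [glrMatrix, hone, Matrix.mul_one, hsys]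
    refine Matrix.inv_eq_right_inv ?_
    calc _ = U * (diagonal (fun i => 1 + μ * lam i) * (Uᵀ * U) * D) * Uᵀ := by
          simp only [Matrix.mul_assoc]
      _ = 1 := by
          rw [h1, Matrix.mul_one, hD, Matrix.diagonal_mul_diagonal]
          simp [hpos, h2]
  have htr : ∑ a, ∑ b, glrMatrix G.laplacian μ Finset.univ a b ^ 2 =
      ((U * D * Uᵀ) * (U * D * Uᵀ)ᵀ).trace := by
    rw [hinv]
    simp only [Matrix.trace, Matrix.diag_apply, Matrix.mul_apply (M := U * D * Uᵀ),
      Matrix.transpose_apply, sq]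
  rw [htr, Matrix.transpose_mul, Matrix.transpose_mul, Matrix.transpose_transpose,
    show U * D * Uᵀ * (U * (Dᵀ * Uᵀ)) = U * (D * (Uᵀ * U) * Dᵀ * Uᵀ) by
      simp only [Matrix.mul_assoc], h1, Matrix.mul_one, Matrix.trace_mul_comm,
    Matrix.mul_assoc, h1, Matrix.mul_one, hD, Matrix.diagonal_transpose,
    Matrix.diagonal_mul_diagonal, Matrix.trace_diagonal]
  exact Finset.sum_congr rfl fun i _ => by rw [sq]

end GraphSampling

end Reconstruction

/-! ### Bias and noise parts of the mean squared error. -/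

section MeanSquaredError

open Matrix

namespace GraphSampling

variable {N : ℕ}

/-- The trace of `A C Aᵀ`. -/
def traceConj (A C : Matrix (Fin N) (Fin N) ℝ) : ℝ :=
  ∑ a, ∑ b, ∑ c, A a b * A a c * C b c

variable {U : Matrix (Fin N) (Fin N) ℝ} {k : ℕ} {Ω : Type u} [MeasurableSpace Ω]
  {P : Measure Ω} {x ε : Ω → Fin N → ℝ}

theorem IsFullBandModel.integral_signal_mul [IsProbabilityMeasure P]
    (h : IsFullBandModel U k P x ε) (b c : Fin N) :
    ∫ w, x w b * x w c ∂P = bandProjection U k b c := by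
  have h1 := covariance_eq_sub (h.signal_memLp b) (h.signal_memLp c)
  rw [h.signal_cov, h.signal_mean, zero_mul, sub_zero] at h1
  exact h1.symm

theorem IsFullBandModel.integral_noise_mul [IsProbabilityMeasure P]
    (h : IsFullBandModel U k P x ε) (b c : Fin N) :
    ∫ w, ε w b * ε w c ∂P = (1 : Matrix (Fin N) (Fin N) ℝ) b c := by
  have h1 := covariance_eq_sub (h.noise_memLp b) (h.noise_memLp c)
  rw [h.noise_cov, h.noise_mean, zero_mul, sub_zero] at h1
  exact h1.symm

theorem IsFullBandModel.integral_cross_mul (h : IsFullBandModel U k P x ε) (b c : Fin N) :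
    ∫ w, x w b * ε w c ∂P = 0 := by
  have hind : IndepFun (fun w => x w b) (fun w => ε w c) P :=
    h.indep.comp (measurable_pi_apply b) (measurable_pi_apply c)
  rw [hind.integral_fun_mul_eq_mul_integral (h.signal_memLp b).aestronglyMeasurable
    (h.noise_memLp c).aestronglyMeasurable, h.signal_mean, zero_mul]

theorem sqNorm_add_smul_expand (A B : Matrix (Fin N) (Fin N) ℝ) (σ : ℝ) (v e : Fin N → ℝ) :
    sqNorm (A *ᵥ v + σ • (B *ᵥ e)) = ∑ a, ∑ b, ∑ c,
      (A a b * A a c * (v b * v c) + 2 * σ * (A a b * B a c) * (v b * e c) +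
        σ ^ 2 * (B a b * B a c) * (e b * e c)) := by
  refine Finset.sum_congr rfl fun a _ => ?_
  have h : (A *ᵥ v + σ • (B *ᵥ e)) a = ∑ b, A a b * v b + σ * ∑ b, B a b * e b := rfl
  rw [h, add_sq, mul_pow, sq (∑ b, A a b * v b), sq (∑ b, B a b * e b), Finset.sum_mul_sum,
    Finset.sum_mul_sum, show 2 * (∑ b, A a b * v b) * (σ * ∑ b, B a b * e b) =
      2 * σ * ((∑ b, A a b * v b) * ∑ b, B a b * e b) by ring, Finset.sum_mul_sum]
  simp only [Finset.mul_sum, ← Finset.sum_add_distrib]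
  exact Finset.sum_congr rfl fun b _ => Finset.sum_congr rfl fun c _ => by ring

/-- Independence and zero means cancel the cross terms. -/
theorem IsFullBandModel.integrable_and_integral_sqNorm [IsProbabilityMeasure P]
    (h : IsFullBandModel U k P x ε)
    (A B : Matrix (Fin N) (Fin N) ℝ) (σ : ℝ) :
    Integrable (fun w => sqNorm (A *ᵥ x w + σ • (B *ᵥ ε w))) P ∧
      ∫ w, sqNorm (A *ᵥ x w + σ • (B *ᵥ ε w)) ∂P =
        traceConj A (bandProjection U k) + σ ^ 2 * ∑ a, ∑ b, B a b ^ 2 := by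
  simp only [sqNorm_add_smul_expand]
  have hxx : ∀ b c, Integrable (fun w => x w b * x w c) P := fun b c =>
    (h.signal_memLp b).integrable_mul (h.signal_memLp c)
  have hxe : ∀ b c, Integrable (fun w => x w b * ε w c) P := fun b c =>
    (h.signal_memLp b).integrable_mul (h.noise_memLp c)
  have hee : ∀ b c, Integrable (fun w => ε w b * ε w c) P := fun b c =>
    (h.noise_memLp b).integrable_mul (h.noise_memLp c)
  have hint : ∀ a b c, Integrable (fun w => A a b * A a c * (x w b * x w c) +
      2 * σ * (A a b * B a c) * (x w b * ε w c) +
        σ ^ 2 * (B a b * B a c) * (ε w b * ε w c)) P := fun a b c =>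
    (((hxx b c).const_mul _).add ((hxe b c).const_mul _)).add ((hee b c).const_mul _)
  refine ⟨integrable_finsetSum _ fun a _ => integrable_finsetSum _ fun b _ =>
    integrable_finsetSum _ fun c _ => hint a b c, ?_⟩
  rw [integral_finsetSum _ fun a _ => integrable_finsetSum _ fun b _ =>
    integrable_finsetSum _ fun c _ => hint a b c, traceConj, Finset.mul_sum,
    ← Finset.sum_add_distrib]
  refine Finset.sum_congr rfl fun a _ => ?_
  rw [integral_finsetSum _ fun b _ => integrable_finsetSum _ fun c _ => hint a b c,
    Finset.mul_sum, ← Finset.sum_add_distrib]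
  refine Finset.sum_congr rfl fun b _ => ?_
  rw [integral_finsetSum _ fun c _ => hint a b c]
  have hterm : ∀ c, ∫ w, (A a b * A a c * (x w b * x w c) +
      2 * σ * (A a b * B a c) * (x w b * ε w c) +
        σ ^ 2 * (B a b * B a c) * (ε w b * ε w c)) ∂P =
      A a b * A a c * bandProjection U k b c +
        σ ^ 2 * (B a b * B a c) * (1 : Matrix (Fin N) (Fin N) ℝ) b c := by
    intro c
    have hadd : Integrable (fun w => A a b * A a c * (x w b * x w c) +
        2 * σ * (A a b * B a c) * (x w b * ε w c)) P :=
      ((hxx b c).const_mul _).add ((hxe b c).const_mul _)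
    rw [integral_add hadd ((hee b c).const_mul _), integral_add ((hxx b c).const_mul _) ((hxe b c).const_mul _),
      integral_const_mul, integral_const_mul, integral_const_mul, h.integral_signal_mul,
      h.integral_cross_mul, h.integral_noise_mul, mul_zero, add_zero]
  simp only [hterm, Finset.sum_add_distrib, Matrix.one_apply, mul_ite, mul_one, mul_zero,
    Finset.sum_ite_eq, Finset.mem_univ, if_true]
  rw [sq (B a b)]

theorem sqNorm_nonneg (v : Fin N → ℝ) : 0 ≤ sqNorm v := Finset.sum_nonneg fun _ _ => sq_nonneg _

theorem traceConj_bandProjection_nonneg (A : Matrix (Fin N) (Fin N) ℝ) :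
    0 ≤ traceConj A (bandProjection U k) := by
  refine Finset.sum_nonneg fun a _ => ?_
  have h : ∑ b, ∑ c, A a b * A a c * bandProjection U k b c =
      ∑ i with i.val < k, (∑ b, A a b * U b i) ^ 2 := by
    symm
    simp only [sq, Finset.sum_mul_sum]
    rw [Finset.sum_comm]
    refine Finset.sum_congr rfl fun b _ => ?_
    rw [Finset.sum_comm]
    refine Finset.sum_congr rfl fun c _ => ?_
    rw [bandProjection, Finset.mul_sum]
    exact Finset.sum_congr rfl fun i _ => by ring
  rw [h]
  exact Finset.sum_nonneg fun i _ => sq_nonneg _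

/-- The error vector is `(R - 1) x + σ R ε`. -/
theorem IsFullBandModel.glrMSE_eq [IsProbabilityMeasure P] {G : WeightedGraph N}
    (h : IsFullBandModel U k P x ε)
    (hG : G.toSimpleGraph.Connected) {μ : ℝ} (hμ : 0 < μ) {S : Finset (Fin N)}
    (hS : S.Nonempty) (σ : ℝ) :
    glrMSE G.laplacian μ P x (fun w => x w + σ • ε w) S =
      ENNReal.ofReal (traceConj (glrMatrix G.laplacian μ S - 1) (bandProjection U k) +
        σ ^ 2 * ∑ a, ∑ b, glrMatrix G.laplacian μ S a b ^ 2) := by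
  set R := glrMatrix G.laplacian μ S with hR
  obtain ⟨h1, h2⟩ := h.integrable_and_integral_sqNorm (R - 1) R σ
  rw [← h2, ofReal_integral_eq_lintegral_ofReal h1 (ae_of_all _ fun w => sqNorm_nonneg _), glrMSE]
  refine lintegral_congr fun w => ?_
  rw [glrReconstruction_eq hG hμ hS (x w + σ • ε w), ← hR, Matrix.sub_mulVec, Matrix.one_mulVec,
    Matrix.mulVec_add, Matrix.mulVec_smul]
  congr 2
  abel

/-- The signal energy is the trace `k` of the band projection; the noise energy is `σ² N`. -/
theorem IsFullBandModel.snr_eq [IsProbabilityMeasure P] {L : Matrix (Fin N) (Fin N) ℝ} {lam : Fin N → ℝ}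
    (h : IsFullBandModel U k P x ε) (hU : IsEigendecomposition L U lam) (hkN : k ≤ N) (σ : ℝ) :
    snr P x (fun w => σ • ε w) = k / (σ ^ 2 * N) := by
  have h1 := (h.integrable_and_integral_sqNorm 1 0 0).2
  have h2 := (h.integrable_and_integral_sqNorm 0 1 σ).2
  have h3 : ∑ a : Fin N, ∑ b, (1 : Matrix (Fin N) (Fin N) ℝ) a b ^ 2 = N := by
    simp [Matrix.one_apply]
  have h4 : traceConj 1 (bandProjection U k) = k := by
    have e1 : traceConj 1 (bandProjection U k) = ∑ a, bandProjection U k a a := by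
      simp [traceConj, Matrix.one_apply]
    rw [e1]
    simp only [bandProjection]
    rw [Finset.sum_comm]
    have e2 : ∀ i, ∑ a, U a i * U a i = 1 := fun i => by
      have := hU.col_dotProduct_col i i
      rw [if_pos rfl] at this
      exact this
    simp only [e2, Finset.sum_const, nsmul_eq_mul, mul_one]
    have e3 : (Finset.univ.filter fun i : Fin N => i.val < k).card = k := by
      rw [Fin.card_filter_val_lt, min_eq_right hkN]
    rw [e3]
  have h5 : traceConj 0 (bandProjection U k) = 0 := by simp [traceConj]
  simp only [Matrix.one_mulVec, Matrix.zero_mulVec, smul_zero, add_zero, zero_add, h3, h4, h5,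
    ne_eq, OfNat.ofNat_ne_zero, not_false_eq_true, zero_pow, zero_mul] at h1 h2
  rw [snr, h1, h2]

end GraphSampling

end MeanSquaredError

/-! ### Size of the optimal sample. -/

section SampleSize

namespace GraphSampling

variable {N : ℕ} {lam : Fin N → ℝ}

/-- Past the midpoint the last summand is `ω(1) = 1`, so `B(m) ≤ B(m - 1)` forces `r N ≥ m (m - 1)`.
The `m - 1` summands are each at least `1`, whence `B(m) ≥ 2 (m - 1) ≥ N`. -/
theorem le_of_boundB_lt (hm : Monotone lam) (h0 : ∀ i, 0 ≤ lam i) {m : ℕ}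
    (hmopt : IsOptimalSampleSize lam m) (hB : boundB lam m < N) : m ≤ (N + 1) / 2 := by
  by_contra hlt
  obtain ⟨⟨hm1, hmN⟩, hmin⟩ := hmopt
  have hm2 : 2 ≤ m := by omega
  have hmle : boundB lam m ≤ boundB lam (m - 1) :=
    hmin (show m - 1 ∈ Set.Icc 1 N from ⟨by omega, by omega⟩)
  have hIcc : Finset.Icc 2 m = insert m (Finset.Icc 2 (m - 1)) := by
    ext i
    simp only [Finset.mem_Icc, Finset.mem_insert]
    omega
  have hlast : omegaK (max 1 (eigenvalueAt lam (N + 2 - m) / eigenvalueAt lam m)) = 1 := by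
    have e : eigenvalueAt lam (N + 2 - m) / eigenvalueAt lam m ≤ 1 := by
      simp only [eigenvalueAt]
      rw [dif_pos (by omega), dif_pos (by omega)]
      exact div_le_one_of_le₀ (hm (by simp only [Fin.mk_le_mk]; omega)) (h0 _)
    rw [max_eq_left e, omegaK_one]
  have hsum : ((m - 1 : ℕ) : ℝ) - 1 ≤ ∑ i ∈ Finset.Icc 2 (m - 1),
      omegaK (max 1 (eigenvalueAt lam (N + 2 - i) / eigenvalueAt lam i)) := by
    have h1 := Finset.card_nsmul_le_sum (Finset.Icc 2 (m - 1))
      (fun i => omegaK (max 1 (eigenvalueAt lam (N + 2 - i) / eigenvalueAt lam i))) 1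
      (fun i _ => one_le_omegaK (lt_of_lt_of_le one_pos (le_max_left _ _)))
    rw [Nat.card_Icc, nsmul_eq_mul, mul_one] at h1
    refine le_trans (le_of_eq ?_) h1
    rw [show m - 1 + 1 - 2 = (m - 1) - 1 by omega, Nat.cast_sub (show 1 ≤ m - 1 by omega)]
    simp
  have hcast : ((m - 1 : ℕ) : ℝ) = m - 1 := by
    rw [Nat.cast_sub (by omega)]
    simp
  have hm1R : (0 : ℝ) < m - 1 := by
    have : (2 : ℝ) ≤ m := by exact_mod_cast hm2
    linarith
  have hmR : (0 : ℝ) < m := by linarith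
  have hN2 : (N : ℝ) ≤ 2 * (m - 1) := by
    have : N ≤ 2 * (m - 1) := by omega
    have h : (N : ℝ) ≤ ((2 * (m - 1) : ℕ) : ℝ) := by exact_mod_cast this
    push_cast [hcast] at h
    exact h
  rw [boundB] at hB
  rw [boundB, boundB] at hmle
  rw [hIcc, Finset.sum_insert (by simp; omega), hlast] at hB hmle
  rw [hcast] at hmle hsum
  set X := spreadR lam * (N : ℝ) with hX
  rw [← mul_div_assoc, ← hX] at hB hmle
  rw [← mul_div_assoc, ← hX] at hmle
  have h1 : 1 + X / m ≤ X / (m - 1) := by linarith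
  have h2 : (m : ℝ) * (m - 1) ≤ X := by
    have h3 : 1 ≤ X / (m - 1) - X / m := by linarith
    have h4 : X / (m - 1) - X / m = X / (m * (m - 1)) := by
      field_simp
      ring
    rw [h4, le_div_iff₀ (by positivity)] at h3
    linarith
  have h5 : (m : ℝ) - 1 ≤ X / m := by
    rw [le_div_iff₀ hmR]
    linarith
  linarith

end GraphSampling

end SampleSize

/-! ### Choice of thresholds and the final comparison. -/

/-- The sum is continuous at `μ = 0`, where it equals `N`. -/
theorem GraphSampling.exists_forall_lt_sum_sq {N : ℕ} (lam : Fin N → ℝ) {b : ℝ}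
    (hb : b < N) :
    ∃ μub : ℝ, 0 < μub ∧ ∀ μ ∈ Set.Ioo 0 μub, b < ∑ i, (1 / (1 + μ * lam i)) ^ 2 := by
  have hcont : ContinuousAt (fun μ : ℝ => ∑ i, (1 / (1 + μ * lam i)) ^ 2) 0 := by
    refine tendsto_finsetSum _ fun i _ => ?_
    have : ContinuousAt (fun μ : ℝ => (1 / (1 + μ * lam i)) ^ 2) 0 :=
      (ContinuousAt.div (by fun_prop) (by fun_prop) (by simp)).pow 2
    exact this
  have hev := hcont.eventually (lt_mem_nhds (a := b) (by simpa using hb))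
  obtain ⟨δ, hδ, h⟩ := Metric.eventually_nhds_iff.1 hev
  refine ⟨δ, hδ, fun μ hμ => h ?_⟩
  rw [Real.dist_eq, sub_zero, abs_of_pos hμ.1]
  exact hμ.2

theorem theorem4 (N : ℕ) (hN : 2 ≤ N) (G : WeightedGraph N) (hG : G.toSimpleGraph.Connected)
    (U : Matrix (Fin N) (Fin N) ℝ) (lam : Fin N → ℝ)
    (hU : IsEigendecomposition G.laplacian U lam)
    (k : ℕ) (hk : 1 ≤ k) (hkN : k ≤ N)
    (mopt : ℕ) (hmopt : IsOptimalSampleSize lam mopt) (hB : boundB lam mopt < (N : ℝ)) :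
    (mopt ≤ ⌈((N : ℝ) + 1) / 2⌉₊ ∧ (Even N → mopt < ⌈((N : ℝ) + 1) / 2⌉₊)) ∧
    ∃ μub : ℝ, 0 < μub ∧ ∃ τ : ℝ → ℝ, (∀ μ ∈ Set.Ioo 0 μub, 0 < τ μ) ∧
      ∀ μ ∈ Set.Ioo 0 μub,
        ∀ (Ω : Type u) [MeasurableSpace Ω] (P : Measure Ω) [IsProbabilityMeasure P]
          (x ε : Ω → Fin N → ℝ) (σ : ℝ),
          IsFullBandModel U k P x ε → 0 < σ →
          snr P x (fun w => σ • ε w) < τ μ →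
          ∀ S : Finset (Fin N), S.card = mopt →
            glrMSE G.laplacian μ P x (fun w => x w + σ • ε w) S <
              glrMSE G.laplacian μ P x (fun w => x w + σ • ε w) Finset.univ := by
  -- The bound `(N + 1) / 2` is rounded down here, which gives the strict inequality for even `N`.
  have hle := le_of_boundB_lt hU.monotone hU.eigenvalue_nonneg hmopt hB
  refine ⟨⟨?_, fun heven => ?_⟩, ?_⟩
  · rw [← Nat.cast_le (α := ℝ)]
    refine le_trans ?_ (Nat.le_ceil _)
    have h1 : 2 * mopt ≤ N + 1 := by omega
    have h2 : (2 : ℝ) * mopt ≤ N + 1 := by exact_mod_cast h1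
    linarith
  · rw [Nat.lt_ceil]
    have h1 : 2 * mopt < N + 1 := by
      obtain ⟨l, hl⟩ := heven
      omega
    have h2 : (2 : ℝ) * mopt < N + 1 := by exact_mod_cast h1
    linarith
  · obtain ⟨μub, hμub, hφ⟩ := exists_forall_lt_sum_sq lam hB
    set φ : ℝ → ℝ := fun μ => ∑ i, (1 / (1 + μ * lam i)) ^ 2
    set bias : ℝ → Finset (Fin N) → ℝ := fun μ S =>
      traceConj (glrMatrix G.laplacian μ S - 1) (bandProjection U k) with hbias
    have hbias0 : ∀ μ S, 0 ≤ bias μ S := fun μ S => traceConj_bandProjection_nonneg _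
    -- Summing over all vertex sets dominates every bias at once, independently of `S`; the added
    -- `1` makes the domination strict and `C` positive.
    set C : ℝ → ℝ := fun μ => 1 + ∑ S, bias μ S with hC
    have hCpos : ∀ μ, 0 < C μ := fun μ =>
      add_pos_of_pos_of_nonneg one_pos (Finset.sum_nonneg fun S _ => hbias0 μ S)
    have hbiasC : ∀ μ S, bias μ S < C μ := fun μ S => by
      have := Finset.single_le_sum (f := bias μ) (fun S _ => hbias0 μ S) (Finset.mem_univ S)
      simp only [hC]
      linarith
    have hkR : (0 : ℝ) < k := by exact_mod_cast hk
    have hNR : (0 : ℝ) < N := by exact_mod_cast (by omega : 0 < N)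
    -- As the SNR is `k / (σ² N)`, lying below this threshold means `C μ < σ² (φ μ - B)`: the noise
    -- gap exceeds any bias.
    refine ⟨μub, hμub, fun μ => k * (φ μ - boundB lam mopt) / (N * C μ), fun μ hμ => ?_, ?_⟩
    · exact div_pos (mul_pos hkR (sub_pos.2 (hφ μ hμ))) (mul_pos hNR (hCpos μ))
    · intro μ hμ Ω _ P _ x ε σ hmodel hσ hsnr S hS
      have hSne : S.Nonempty := by
        rw [← Finset.card_pos, hS]
        exact hmopt.1.1
      have hune : (Finset.univ : Finset (Fin N)).Nonempty := hSne.mono (Finset.subset_univ S)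
      have hFrob : ∑ a, ∑ b, glrMatrix G.laplacian μ S a b ^ 2 ≤ boundB lam mopt := by
        obtain ⟨n, rfl⟩ : ∃ n, N = n + 1 := ⟨N - 1, by omega⟩
        rw [← hS]
        exact sum_sq_glrMatrix_le (by omega) hG hU hμ.1 hSne
      have hgap := sub_pos.2 (hφ μ hμ)
      have hσ2 : 0 < σ ^ 2 := by positivity
      rw [hmodel.snr_eq hU hkN, div_lt_div_iff₀ (mul_pos hσ2 hNR) (mul_pos hNR (hCpos μ))] at hsnr
      have hlarge : C μ < σ ^ 2 * (φ μ - boundB lam mopt) := by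
        have hkN' : (0 : ℝ) < k * N := mul_pos hkR hNR
        refine lt_of_mul_lt_mul_left ?_ hkN'.le
        linarith
      have hstrict : bias μ S + σ ^ 2 * ∑ a, ∑ b, glrMatrix G.laplacian μ S a b ^ 2 <
          bias μ Finset.univ + σ ^ 2 * φ μ := by
        have h1 := mul_le_mul_of_nonneg_left hFrob hσ2.le
        have h2 := hbiasC μ S
        have h3 := hbias0 μ Finset.univ
        linarith
      rw [hmodel.glrMSE_eq hG hμ.1 hSne, hmodel.glrMSE_eq hG hμ.1 hune,
        sum_sq_glrMatrix_univ hU hμ.1]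
      refine (ENNReal.ofReal_lt_ofReal_iff ?_).2 hstrict
      have h1 := hbias0 μ S
      have h2 : 0 ≤ σ ^ 2 * ∑ a, ∑ b, glrMatrix G.laplacian μ S a b ^ 2 :=
        mul_nonneg hσ2.le (Finset.sum_nonneg fun a _ => Finset.sum_nonneg fun b _ => sq_nonneg _)
      linarith
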